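/- **Setting and notation.** For $x\in\mathbb R^m$ let $\|x\|_1,\|x\|_2,\|x\|_\infty$ be the usual norms; a unit vector is a vector with $\|x\|_2=1$. Given $X_1,\dots,X_N\in\mathbb R^n$ (a realization of i.i.d. standard Gaussian vectors), let $A$ be the $n\times N$ matrix with columns $X_1,\dots,X_N$, let $A_J$ be its submatrix with columns indexed by $J\subset[N]$, and let $P_{N,n}=\mathrm{conv}\{\pm X_j:\ j\in[N]\}$, with Minkowski functional $\|\cdot\|_{P_{N,n}}$. Let $s_{\max}(M)=\|M\|$ and $s_{\min}(M)=\min_{\|x\|_2=1}\|Mx\|_2$ for a matrix $M$ with at least as many rows as columns. Let $\mathbb P_\sigma,\mathbb E_\sigma$ refer to the uniform distribution of $\sigma\in\{-1,1\}^k$. $\log$ is the natural logarithm. For $c\in(0,1/100]$, let $\Omega_{\rm sparse}=\Omega_{\rm sparse}(c)$ be the event that $\|A\|\le 4\sqrt N$, that $s_{\min}(A^\top)\ge\frac12(\sqrt N-\sqrt n)$, and that for every non-empty $J\subset[N]$ with $|J|\le c\,n$, $$\sqrt n\Big(1-\sqrt{|J|/n}\,\log\tfrac n{|J|}\Big)\le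 s_{\min}(A_J)\le s_{\max}(A_J)\le \sqrt n\Big(1+\sqrt{|J|/n}\,\log\tfrac n{|J|}\Big).$$ For $\tilde C>0$, let $\Omega_{\rm dot}=\Omega_{\rm dot}(\tilde C)$ be the event that for every integer $2\le k\le n/2$ and all unit vectors $y_1,\dots,y_k\in\mathbb R^n$: 1. for every $t\ge\tilde C\log^2k$, the number of $j\in[N]$ with $\mathbb P_\sigma\{|\langle X_j,\sum_i\sigma_iy_i\rangle|\ge t\sqrt k\}\ge k^{-100}$ is at most $n\,\tilde C\,(\log t)\,(\log k)^4/t^2$; 2. the number of $j\in[N]$ for which the orthogonal projection of $X_j$ onto $\mathrm{span}\{y_1,\dots,y_k\}$ has Euclidean length greater than $\tilde C k^{10}$ is at most $n\,k^{-10}$. **Proposition.** Let $K'\ge K>1$, and let $c=c(K,K')\in(0,1/100]$ and $\tilde C=\tilde C(K,K')>2c^{-1}$ be fixed. There is a constant $C\ge1$, depending only on $K,K'$ (through $c,\tilde C$ as well), with the following property. Let $n\ge c^{-1}$ and $K\le N/n\le K'$, and fix any realization of $X_1,\dots,X_N$ in $\Omega_{\rm sparse}(c)\cap\Omega_{\rm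 dot}(\tilde C)$. Let $1\le k\le n/2$ and let $y_1,\dots,y_k\in\mathbb R^n$ be unit vectors with $\|y_i\|_{P_{N,n}}\ge C\,k^{-1/9}$ for every $i\le k$. Then $$\mathbb E_\sigma\Big\|\sum_{i=1}^k\sigma_iy_i\Big\|_{P_{N,n}}\ge k^{1/8}.$$ Moreover, maps $\beta:\mathbb R^n\to\mathbb R^N$ with $v=\sum_j\beta_j(v)X_j$ and $\|\beta(v)\|_1=\|v\|_{P_{N,n}}$ for all $v\in\mathbb R^n$ exist, and for each of them $\mathbb E_\sigma\|\beta(\sum_i\sigma_iy_i)\|_1=\mathbb E_\sigma\|\sum_i\sigma_iy_i\|_{P_{N,n}}$. In particular, the embedding $e_i\mapsto y_i$ of $\ell_\infty^k$ has distortion polynomial in $k$: whenever $a,b>0$ satisfy $a\|v\|_\infty\le\|\sum_iv_iy_i\|_{P_{N,n}}\le b\|v\|_\infty$ for all $v\in\mathbb R^k$, one has $b/a\ge C^{-1}k^{1/8}$. -/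

import Mathlib

noncomputable section

namespace GaussianPolytope

/-- The matrix `A` whose columns are the vectors `X 0, …, X (N - 1)` of `ℝⁿ`. -/
def colMatrix {N n : ℕ} (X : Fin N → EuclideanSpace ℝ (Fin n)) : Matrix (Fin n) (Fin N) ℝ :=
  Matrix.of fun i j => X j i

/-- The submatrix `M_J` formed by the columns of `M` indexed by `J`. -/
def colSubmatrix {N n : ℕ} (M : Matrix (Fin n) (Fin N) ℝ) (J : Finset (Fin N)) :
    Matrix (Fin n) J ℝ :=
  M.submatrix id (fun j : J => (j : Fin N))

/-- The largest singular value (the spectral norm) of a real matrix: its operator norm between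
Euclidean spaces. -/
def sMax {m p : Type*} [Fintype m] [Fintype p] [DecidableEq p] (M : Matrix m p ℝ) : ℝ :=
  ‖LinearMap.toContinuousLinearMap (Matrix.toEuclideanLin M)‖

/-- The smallest singular value of a real matrix with at least as many rows as columns: the
minimum of `‖M x‖₂` over Euclidean unit vectors `x`. -/
def sMin {m p : Type*} [Fintype m] [Fintype p] [DecidableEq p] (M : Matrix m p ℝ) : ℝ :=
  ⨅ x : Metric.sphere (0 : EuclideanSpace ℝ p) 1, ‖Matrix.toEuclideanLin M x‖

/-- The polytope `P = conv {± X j}`. -/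
def polytope {N n : ℕ} (X : Fin N → EuclideanSpace ℝ (Fin n)) : Set (EuclideanSpace ℝ (Fin n)) :=
  convexHull ℝ (Set.range X ∪ Set.range (fun j => -X j))

/-- The norm `‖v‖_P` with unit ball `P = conv {± X j}`: the Minkowski functional of `P`. -/
def polyNorm {N n : ℕ} (X : Fin N → EuclideanSpace ℝ (Fin n))
    (v : EuclideanSpace ℝ (Fin n)) : ℝ :=
  gauge (polytope X) v

/-- The sign combination `∑ i, σ i • y i`, for signs `σ ∈ {-1, 1}ᵏ` (`ℤˣ = {-1, 1}`). -/
def signSum {k n : ℕ} (y : Fin k → EuclideanSpace ℝ (Fin n)) (σ : Fin k → ℤˣ) :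
    EuclideanSpace ℝ (Fin n) :=
  ∑ i, (((σ i : ℤˣ) : ℤ) : ℝ) • y i

/-- Probability of a set of signs under the uniform distribution on `{-1, 1}ᵏ`. -/
def signProb {k : ℕ} (S : Set (Fin k → ℤˣ)) : ℝ :=
  (S.ncard : ℝ) / 2 ^ k

/-- Expectation with respect to the uniform distribution on `{-1, 1}ᵏ`. -/
def signExp {k : ℕ} (f : (Fin k → ℤˣ) → ℝ) : ℝ :=
  (∑ σ, f σ) / 2 ^ k

/-- The event `Ω_sparse` (with parameter `c`), as a subset of the space of all realizations of
`X 0, …, X (N - 1)`: bounds on the extreme singular values of the matrix `A` with columns `X j`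
and of its submatrices with at most `c n` columns. -/
def sparseSingularValuesEvent (N n : ℕ) (c : ℝ) : Set (Fin N → EuclideanSpace ℝ (Fin n)) :=
  {X |
    sMax (colMatrix X) ≤ 4 * √(N : ℝ) ∧
    (1 / 2) * (√(N : ℝ) - √(n : ℝ)) ≤ sMin (colMatrix X).transpose ∧
    ∀ J : Finset (Fin N), J.Nonempty → (J.card : ℝ) ≤ c * n →
      √(n : ℝ) * (1 - √((J.card : ℝ) / n) * Real.log ((n : ℝ) / J.card))
          ≤ sMin (colSubmatrix (colMatrix X) J) ∧
      sMin (colSubmatrix (colMatrix X) J) ≤ sMax (colSubmatrix (colMatrix X) J) ∧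
      sMax (colSubmatrix (colMatrix X) J)
          ≤ √(n : ℝ) * (1 + √((J.card : ℝ) / n) * Real.log ((n : ℝ) / J.card))}

/-- The event `Ω_dotprod` (with parameter `Ct`), as a subset of the space of all realizations of
`X 0, …, X (N - 1)`: statistics of the inner products of the `X j` with random sign combinations
of unit vectors, and of the projections of the `X j` onto spans of unit vectors. -/
def dotProdStatEvent (N n : ℕ) (Ct : ℝ) : Set (Fin N → EuclideanSpace ℝ (Fin n)) :=
  {X |
    (∀ k : ℕ, 2 ≤ k → (k : ℝ) ≤ (n : ℝ) / 2 → ∀ t : ℝ, Ct * Real.log k ^ 2 ≤ t →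
      ∀ y : Fin k → EuclideanSpace ℝ (Fin n), (∀ i, ‖y i‖ = 1) →
        ({j : Fin N | 1 / (k : ℝ) ^ 100 ≤
            signProb {σ : Fin k → ℤˣ | t * √(k : ℝ) ≤ |inner ℝ (X j) (signSum y σ)|}}.ncard : ℝ)
          ≤ n * (Ct * Real.log t * Real.log k ^ 4 / t ^ 2)) ∧
    (∀ k : ℕ, 2 ≤ k → (k : ℝ) ≤ (n : ℝ) / 2 →
      ∀ y : Fin k → EuclideanSpace ℝ (Fin n), (∀ i, ‖y i‖ = 1) →
        ({j : Fin N | Ct * (k : ℝ) ^ 10 <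
            ‖(Submodule.span ℝ (Set.range y)).starProjection (X j)‖}.ncard : ℝ)
          ≤ n * ((k : ℝ) ^ 10)⁻¹)}

/-- `β` is a choice of coefficient vectors: `v = ∑ j, β v j • X j` and `‖β v‖₁ = ‖v‖_P` for every
`v`. No measurability of the choice is required, so a statement about all such `β` covers in
particular every Borel measurable choice. -/
def IsCoeffMap {N n : ℕ} (X : Fin N → EuclideanSpace ℝ (Fin n))
    (β : EuclideanSpace ℝ (Fin n) → Fin N → ℝ) : Prop :=
  ∀ v, v = ∑ j, β v j • X j ∧ ∑ j, |β v j| = polyNorm X v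

end GaussianPolytope

end

/-! ### Restricted isometries -/

namespace GaussianPolytope

/-! Suppose the expected norm of `Y = ∑ σ_i y_i` were below `k^(1/8)`, and let `b(σ)` be a
coefficient vector of `Y` of least `ℓ₁` norm. Since `y_i = E[σ_i Y]`, the averages `E[σ_i b_j]` are
coefficients of `y_i`, so `∑_i ‖y_i‖_P ≤ ∑_{i,j} |E[σ_i b_j]|` (`polyNorm_le_sum_abs_signExp`). The
hypothesis makes the left side at least `k^(8/9)`; the contradiction is that the right side is
`O(k^(177/200))`, and `177/200 < 8/9`.

Signs are orthonormal, so Bessel and Cauchy-Schwarz bound the part of the double sum over `j ∈ s` by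
`√k * √(|s| * E ∑_{j ∈ s} b_j²)`. As `‖b‖₂² = O(‖Y‖² / n)` (`sqrt_sum_sq_coeff_le`), this alone
gives `O(k)`, and a power of `k` must be saved. With `u = k^(1/200)`, call `(j, σ)` bad when `|⟨X_j,
Y⟩| ≥ u^25 √k = u^125`. The first condition of `dotProdStatEvent` says that few `j` are bad with
probability at least `k^(-100)`: for these `|s|` is small. For the other `j` the bad signs are so
rare that a crude bound suffices.

On good pairs the mass of `b` itself is small (`sum_sq_coeff_nearly_orthogonal_le`). Coefficients
below `τ = u^128 / n` have mass at most `τ ‖b‖₁`, which is small on average because `E ‖b‖₁ <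
k^(1/8)`. Coefficients above `τ` are few, hence their columns are almost orthogonal to one another
and to the other columns (`RestrictedIsometry`); a large coefficient would then force a large inner
product `⟨X_j, Y⟩`, so their mass is small too (`RestrictedIsometry.sum_sq_large_le`).

For bounded `k` the hypothesis on `‖y_i‖_P` fails once `C` is large, since `‖·‖_P` is at most a
constant times the Euclidean norm. -/

/-- If every `m` of the numbers `g j`, `j ∈ R`, have Euclidean norm at most `κ`, then pairing them
with `β` costs at most `κ * (‖β‖₂ + ‖β‖₁ / √m)`. -/
theorem abs_sum_mul_le_of_forall_card_le {ι : Type*} [Fintype ι] (R : Finset ι) (g β : ι → ℝ) {κ : ℝ} (hκ : 0 ≤ κ)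
    {m : ℕ} (hm : 0 < m) (h : ∀ S ⊆ R, S.card ≤ m → √(∑ j ∈ S, g j ^ 2) ≤ κ) :
    |∑ j ∈ R, β j * g j| ≤ κ * (√(∑ j, β j ^ 2) + (∑ j, |β j|) / √m) := by
  have hm' : 0 < √(m : ℝ) := Real.sqrt_pos.2 (by exact_mod_cast hm)
  -- At most `m` entries exceed `κ / √m`; they are paired by Cauchy-Schwarz, and the others cost at
  -- most `κ / √m` per unit of `‖β‖₁`.
  set G := R.filter fun j => κ / √m < |g j| with hG
  have hcard : G.card ≤ m := by
    by_contra! hlt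
    obtain ⟨S, hSG, hS⟩ := Finset.exists_subset_card_eq hlt.le
    have h1 := h S (hSG.trans (Finset.filter_subset _ _)) hS.le
    have h2 : ∑ j ∈ S, κ ^ 2 / m < ∑ j ∈ S, g j ^ 2 := by
      refine Finset.sum_lt_sum_of_nonempty (Finset.card_pos.1 (hS ▸ hm)) fun j hj => ?_
      have := (Finset.mem_filter.1 (hSG hj)).2
      rw [← sq_abs (g j), ← Real.sq_sqrt (Nat.cast_nonneg (α := ℝ) m), ← div_pow]
      exact pow_lt_pow_left₀ this (by positivity) two_ne_zero
    rw [Finset.sum_const, hS, nsmul_eq_mul,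
      mul_div_cancel₀ _ (by exact_mod_cast hm.ne')] at h2
    exact absurd (Real.lt_sqrt_of_sq_lt h2) (not_lt.2 h1)
  rw [← Finset.sum_filter_add_sum_filter_not R (fun j => κ / √m < |g j|), mul_add]
  refine (abs_add_le _ _).trans (add_le_add ?_ ?_)
  · calc |∑ j ∈ G, β j * g j| ≤ √(∑ j ∈ G, β j ^ 2) * √(∑ j ∈ G, g j ^ 2) := by
          rw [← Real.sqrt_mul (Finset.sum_nonneg fun _ _ => sq_nonneg _)]
          exact Real.abs_le_sqrt (Finset.sum_mul_sq_le_sq_mul_sq _ _ _)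
      _ ≤ √(∑ j, β j ^ 2) * κ := by
          gcongr
          · exact Finset.subset_univ _
          · exact h G (Finset.filter_subset _ _) hcard
      _ = _ := mul_comm _ _
  · calc |∑ j ∈ R.filter (fun j => ¬ κ / √m < |g j|), β j * g j|
        ≤ ∑ j ∈ R.filter (fun j => ¬ κ / √m < |g j|), |β j| * (κ / √m) := by
          refine (Finset.abs_sum_le_sum_abs _ _).trans (Finset.sum_le_sum fun j hj => ?_)
          rw [abs_mul]
          gcongr
          exact not_lt.1 (Finset.mem_filter.1 hj).2
      _ ≤ ∑ j, |β j| * (κ / √m) :=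
          Finset.sum_le_sum_of_subset_of_nonneg (Finset.subset_univ _) fun _ _ _ => by positivity
      _ = _ := by rw [← Finset.sum_mul]; ring

section RestrictedIsometry

variable {ι E : Type*} [DecidableEq ι] [NormedAddCommGroup E] [InnerProductSpace ℝ E]

/-- Every linear combination of at most `M` of the vectors `X j` has norm `√n * (1 ± δ)` times the
Euclidean norm of its coefficients. -/
def RestrictedIsometry (X : ι → E) (n δ : ℝ) (M : ℕ) : Prop :=
  ∀ S : Finset ι, S.card ≤ M → ∀ β : ι → ℝ,
    (1 - δ) ^ 2 * n * ∑ j ∈ S, β j ^ 2 ≤ ‖∑ j ∈ S, β j • X j‖ ^ 2 ∧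
    ‖∑ j ∈ S, β j • X j‖ ^ 2 ≤ (1 + δ) ^ 2 * n * ∑ j ∈ S, β j ^ 2

/-- Polarization: rescale the two vectors so that their coefficients have equal Euclidean norm and
compare the squared norms of the sum and the difference. The gap `(1 + δ)² - (1 - δ)² = 4δ` gives
the bound. -/
theorem RestrictedIsometry.inner_le {X : ι → E} {n δ : ℝ} {M : ℕ}
    (h : RestrictedIsometry X n δ M) {J S : Finset ι} (hd : Disjoint J S)
    (hc : J.card + S.card ≤ M) (β γ : ι → ℝ) :
    inner ℝ (∑ j ∈ J, β j • X j) (∑ j ∈ S, γ j • X j) ≤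
      2 * n * δ * √(∑ j ∈ J, β j ^ 2) * √(∑ j ∈ S, γ j ^ 2) := by
  set U := ∑ j ∈ J, β j • X j with hU
  set V := ∑ j ∈ S, γ j • X j with hV
  have hA0 : 0 ≤ ∑ j ∈ J, β j ^ 2 := Finset.sum_nonneg fun _ _ => sq_nonneg _
  have hB0 : 0 ≤ ∑ j ∈ S, γ j ^ 2 := Finset.sum_nonneg fun _ _ => sq_nonneg _
  set a := √(∑ j ∈ J, β j ^ 2) with ha
  set b := √(∑ j ∈ S, γ j ^ 2) with hb
  have ha2 : a ^ 2 = ∑ j ∈ J, β j ^ 2 := Real.sq_sqrt hA0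
  have hb2 : b ^ 2 = ∑ j ∈ S, γ j ^ 2 := Real.sq_sqrt hB0
  obtain h0 | hapos : 0 = a ∨ 0 < a := (Real.sqrt_nonneg _).eq_or_lt
  · have : U = 0 := Finset.sum_eq_zero fun j hj => by
      have hz : ∑ j ∈ J, β j ^ 2 = 0 := by rw [← ha2, ← h0]; ring
      have := (Finset.sum_eq_zero_iff_of_nonneg fun _ _ => sq_nonneg _).1 hz j hj
      rw [pow_eq_zero_iff two_ne_zero] at this
      rw [this, zero_smul]
    rw [this, ← h0]; simp
  obtain h0 | hbpos : 0 = b ∨ 0 < b := (Real.sqrt_nonneg _).eq_or_lt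
  · have : V = 0 := Finset.sum_eq_zero fun j hj => by
      have hz : ∑ j ∈ S, γ j ^ 2 = 0 := by rw [← hb2, ← h0]; ring
      have := (Finset.sum_eq_zero_iff_of_nonneg fun _ _ => sq_nonneg _).1 hz j hj
      rw [pow_eq_zero_iff two_ne_zero] at this
      rw [this, zero_smul]
    rw [this, ← h0]; simp
  have key : ∀ e : ℝ, e ^ 2 = 1 →
      (1 - δ) ^ 2 * n * (2 * a ^ 2 * b ^ 2) ≤ ‖b • U + (e * a) • V‖ ^ 2 ∧
      ‖b • U + (e * a) • V‖ ^ 2 ≤ (1 + δ) ^ 2 * n * (2 * a ^ 2 * b ^ 2) := by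
    intro e he
    have := h (J ∪ S) (by rw [Finset.card_union_of_disjoint hd]; exact hc)
      (fun j => if j ∈ J then b * β j else (e * a) * γ j)
    have hS : ∀ j ∈ S, j ∉ J := fun j hj hj' => Finset.disjoint_left.1 hd hj' hj
    rw [Finset.sum_union hd, Finset.sum_union hd] at this
    have e1 : ∑ j ∈ J, (if j ∈ J then b * β j else (e * a) * γ j) ^ 2 = b ^ 2 * a ^ 2 := by
      rw [ha2, Finset.mul_sum]
      exact Finset.sum_congr rfl fun j hj => by rw [if_pos hj]; ring
    have e2 : ∑ j ∈ S, (if j ∈ J then b * β j else (e * a) * γ j) ^ 2 = a ^ 2 * b ^ 2 := by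
      rw [hb2, Finset.mul_sum]
      exact Finset.sum_congr rfl fun j hj => by
        rw [if_neg (hS j hj)]; linear_combination a ^ 2 * γ j ^ 2 * he
    have e3 : ∑ j ∈ J, (if j ∈ J then b * β j else (e * a) * γ j) • X j = b • U := by
      rw [hU, Finset.smul_sum]
      exact Finset.sum_congr rfl fun j hj => by rw [if_pos hj, mul_smul]
    have e4 : ∑ j ∈ S, (if j ∈ J then b * β j else (e * a) * γ j) • X j = (e * a) • V := by
      rw [hV, Finset.smul_sum]
      exact Finset.sum_congr rfl fun j hj => by rw [if_neg (hS j hj), mul_smul]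
    rw [e1, e2, e3, e4] at this
    convert this using 2 <;> ring
  have k1 := (key 1 (by norm_num)).2
  have k2 := (key (-1) (by norm_num)).1
  rw [norm_add_sq_real] at k1 k2
  simp only [inner_smul_left, inner_smul_right, norm_smul, mul_pow, Real.norm_eq_abs, sq_abs,
    abs_mul, RCLike.conj_to_real] at k1 k2
  have : (a * b) * inner ℝ U V ≤ (a * b) * (2 * n * δ * a * b) := by nlinarith
  exact le_of_mul_le_mul_left this (by positivity)

/-- Duality: use the inner products themselves as the second coefficient family in
`RestrictedIsometry.inner_le`. -/
theorem RestrictedIsometry.sum_inner_sq_le {X : ι → E} {n δ : ℝ} {M : ℕ}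
    (h : RestrictedIsometry X n δ M) (hn : 0 ≤ n) (hδ : 0 ≤ δ) {J S : Finset ι}
    (hd : Disjoint J S) (hc : J.card + S.card ≤ M) (β : ι → ℝ) :
    √(∑ j ∈ S, (inner ℝ (∑ i ∈ J, β i • X i) (X j)) ^ 2) ≤
      2 * n * δ * √(∑ j ∈ J, β j ^ 2) := by
  have := h.inner_le hd hc β (fun j => inner ℝ (∑ i ∈ J, β i • X i) (X j))
  rw [inner_sum] at this
  simp only [inner_smul_right, ← sq] at this
  set s := ∑ j ∈ S, (inner ℝ (∑ i ∈ J, β i • X i) (X j)) ^ 2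
  have hs : 0 ≤ s := Finset.sum_nonneg fun _ _ => sq_nonneg _
  rcases (Real.sqrt_nonneg s).eq_or_lt with h0 | h0
  · rw [← h0]; positivity
  · refine le_of_mul_le_mul_right ?_ h0
    rwa [Real.mul_self_sqrt hs]

/-- Large coefficients of `Y = ∑ j, β j • X j` at vectors `X j` nearly orthogonal to `Y` carry
little Euclidean mass. -/
theorem RestrictedIsometry.sum_sq_large_le [Fintype ι] {X : ι → E} {n δ τ r : ℝ} {m : ℕ}
    (h : RestrictedIsometry X n δ (2 * m)) (hn : 0 < n) (hδ : 0 ≤ δ) (hδ' : δ ≤ 1 / 4)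
    (hm : 0 < m) (hr : r ≤ n * τ / 16) (β : ι → ℝ)
    {J : Finset ι} (hJ : J.card ≤ m) (hJτ : ∀ j ∈ J, τ ≤ |β j|)
    (hJr : ∀ j ∈ J, |inner ℝ (X j) (∑ i, β i • X i)| ≤ r) :
    ∑ j ∈ J, β j ^ 2 ≤ 16 * δ ^ 2 * (√(∑ j, β j ^ 2) + (∑ j, |β j|) / √m) ^ 2 := by
  set Y := ∑ i, β i • X i with hY
  set z := ∑ i ∈ J, β i • X i with hz
  set a := √(∑ j ∈ J, β j ^ 2) with ha
  set B := √(∑ j, β j ^ 2) + (∑ j, |β j|) / √m with hB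
  have hA0 : 0 ≤ ∑ j ∈ J, β j ^ 2 := Finset.sum_nonneg fun _ _ => sq_nonneg _
  have hB0 : 0 ≤ B := by positivity
  have ha2 : a ^ 2 = ∑ j ∈ J, β j ^ 2 := Real.sq_sqrt hA0
  have ha0 : 0 ≤ a := Real.sqrt_nonneg _
  have h1 := (h J (by omega) β).1
  rw [← hz, ← ha2] at h1
  -- Any `m` columns outside `J` have nearly zero inner products with `z`; this is why sets of size
  -- `2 * m` are needed.
  have h2 : |∑ j ∈ Jᶜ, β j * inner ℝ z (X j)| ≤ (2 * n * δ * a) * B := by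
    refine abs_sum_mul_le_of_forall_card_le _ _ _ (by positivity) hm fun S hS hSm => ?_
    exact h.sum_inner_sq_le hn.le hδ
      (Finset.disjoint_left.2 fun j hj hj' => Finset.mem_compl.1 (hS hj') hj) (by omega) β
  have h3 : inner ℝ z Y = ‖z‖ ^ 2 + ∑ j ∈ Jᶜ, β j * inner ℝ z (X j) := by
    rw [hY, ← Finset.sum_add_sum_compl J, inner_add_right, ← hz, real_inner_self_eq_norm_sq,
      inner_sum]
    simp only [inner_smul_right]
  -- On `J` the inner products with `Y` are at most `n * τ / 16 ≤ n * |β j| / 16`.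
  have h4 : inner ℝ z Y ≤ n / 16 * a ^ 2 := by
    rw [hz, sum_inner, ha2, Finset.mul_sum]
    refine Finset.sum_le_sum fun j hj => ?_
    rw [real_inner_smul_left, ← sq_abs (β j)]
    have hr' := hJr j hj
    have hτ' := hJτ j hj
    calc β j * inner ℝ (X j) Y ≤ |β j| * |inner ℝ (X j) Y| := by
          rw [← abs_mul]; exact le_abs_self _
      _ ≤ |β j| * (n * |β j| / 16) := by
          gcongr
          refine hr'.trans (hr.trans ?_)
          gcongr
      _ = _ := by ring
  -- As `δ ≤ 1 / 4`, `‖z‖² ≥ 9/16 * n * a²`; subtracting `n / 16 * a²` leaves half of `n * a²` below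
  -- the cross term.
  have h5 : n * a * a ≤ n * a * (4 * δ * B) := by
    have h6 := (abs_le.1 h2).1
    have h7 : (9 / 16 : ℝ) ≤ (1 - δ) ^ 2 := by nlinarith
    have h8 : 9 / 16 * (n * a ^ 2) ≤ (1 - δ) ^ 2 * (n * a ^ 2) := by gcongr
    nlinarith
  rw [← ha2]
  rcases ha0.eq_or_lt with h0 | h0
  · rw [← h0]; norm_num; positivity
  · have : a ≤ 4 * δ * B := le_of_mul_le_mul_left h5 (by positivity)
    calc a ^ 2 ≤ (4 * δ * B) ^ 2 := by gcongr
      _ = _ := by ring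

end RestrictedIsometry

end GaussianPolytope

/-! ### Consequences of the bounds on singular values -/

namespace GaussianPolytope

section SingularValues

theorem norm_toEuclideanLin_le_sMax {m p : Type*} [Fintype m] [Fintype p] [DecidableEq p]
    (M : Matrix m p ℝ) (x : EuclideanSpace ℝ p) :
    ‖Matrix.toEuclideanLin M x‖ ≤ sMax M * ‖x‖ :=
  (LinearMap.toContinuousLinearMap (Matrix.toEuclideanLin M)).le_opNorm x

theorem sMin_mul_norm_le {m p : Type*} [Fintype m] [Fintype p] [DecidableEq p]
    (M : Matrix m p ℝ) (x : EuclideanSpace ℝ p) :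
    sMin M * ‖x‖ ≤ ‖Matrix.toEuclideanLin M x‖ := by
  rcases eq_or_ne x 0 with rfl | hx
  · simp
  have hx' : 0 < ‖x‖ := norm_pos_iff.2 hx
  have hmem : ‖x‖⁻¹ • x ∈ Metric.sphere (0 : EuclideanSpace ℝ p) 1 := by
    rw [mem_sphere_zero_iff_norm, norm_smul, norm_inv, norm_norm, inv_mul_cancel₀ hx'.ne']
  have h : sMin M ≤ ‖Matrix.toEuclideanLin M (‖x‖⁻¹ • x)‖ :=
    ciInf_le ⟨0, by rintro _ ⟨y, rfl⟩; exact norm_nonneg _⟩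
      (⟨_, hmem⟩ : Metric.sphere (0 : EuclideanSpace ℝ p) 1)
  rwa [map_smul, norm_smul, norm_inv, norm_norm, ← div_eq_inv_mul, le_div_iff₀ hx'] at h

variable {N n : ℕ} {X : Fin N → EuclideanSpace ℝ (Fin n)} {c : ℝ}

theorem toEuclideanLin_colMatrix (X : Fin N → EuclideanSpace ℝ (Fin n)) (β : Fin N → ℝ) :
    Matrix.toEuclideanLin (colMatrix X) (WithLp.toLp 2 β) = ∑ j, β j • X j := by
  ext i
  simp [colMatrix, Matrix.mulVec, dotProduct, mul_comm]

theorem toEuclideanLin_colSubmatrix (X : Fin N → EuclideanSpace ℝ (Fin n)) (J : Finset (Fin N))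
    (β : Fin N → ℝ) :
    Matrix.toEuclideanLin (colSubmatrix (colMatrix X) J) (WithLp.toLp 2 fun j : J => β j) =
      ∑ j ∈ J, β j • X j := by
  ext i
  rw [← Finset.sum_coe_sort J (fun j => β j • X j)]
  simp [colMatrix, colSubmatrix, Matrix.mulVec, dotProduct, mul_comm]

theorem toEuclideanLin_transpose_colMatrix (X : Fin N → EuclideanSpace ℝ (Fin n))
    (w : EuclideanSpace ℝ (Fin n)) (j : Fin N) :
    Matrix.toEuclideanLin (colMatrix X).transpose w j = inner ℝ (X j) w := by
  simp [colMatrix, Matrix.mulVec, dotProduct, PiLp.inner_apply, mul_comm]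

theorem norm_sum_smul_le (hX : X ∈ sparseSingularValuesEvent N n c) (β : Fin N → ℝ) :
    ‖∑ j, β j • X j‖ ≤ 4 * √(N : ℝ) * √(∑ j, β j ^ 2) := by
  have h := norm_toEuclideanLin_le_sMax (colMatrix X) (WithLp.toLp 2 β)
  rw [toEuclideanLin_colMatrix, EuclideanSpace.norm_eq (WithLp.toLp 2 β)] at h
  simp only [Real.norm_eq_abs, sq_abs] at h
  exact h.trans (mul_le_mul_of_nonneg_right hX.1 (Real.sqrt_nonneg _))

theorem mul_norm_le_sqrt_sum_inner_sq (hX : X ∈ sparseSingularValuesEvent N n c)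
    (w : EuclideanSpace ℝ (Fin n)) :
    1 / 2 * (√(N : ℝ) - √(n : ℝ)) * ‖w‖ ≤ √(∑ j, inner ℝ (X j) w ^ 2) := by
  have h := sMin_mul_norm_le (colMatrix X).transpose w
  rw [EuclideanSpace.norm_eq (Matrix.toEuclideanLin _ w)] at h
  simp only [toEuclideanLin_transpose_colMatrix, Real.norm_eq_abs, sq_abs] at h
  exact (mul_le_mul_of_nonneg_right hX.2.1 (norm_nonneg _)).trans h

/-- Smaller sets are padded to exactly `M` columns with zero coefficients, so that only the value of
`√x * log x⁻¹` at `x = M / n` enters and no monotonicity is needed. -/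
theorem restrictedIsometry (hX : X ∈ sparseSingularValuesEvent N n c) {M : ℕ} (hM : 0 < M)
    (hMc : (M : ℝ) ≤ c * n) (hMN : M ≤ N) {δ : ℝ}
    (hδ : √((M : ℝ) / n) * Real.log ((n : ℝ) / M) ≤ δ) (hδ1 : δ ≤ 1) :
    RestrictedIsometry X n δ M := by
  intro S hS β
  obtain ⟨T, hST, hT⟩ := Finset.exists_superset_card_eq hS (by simpa using hMN)
  obtain ⟨h1, -, h2⟩ := hX.2.2 T (Finset.card_pos.1 (hT ▸ hM)) (by rw [hT]; exact hMc)
  rw [hT] at h1 h2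
  set γ : Fin N → ℝ := fun j => if j ∈ S then β j else 0 with hγ
  have e1 : ∑ j ∈ T, γ j • X j = ∑ j ∈ S, β j • X j := by
    simp only [hγ, ite_smul, zero_smul]
    rw [← Finset.sum_filter, Finset.filter_mem_eq_inter, Finset.inter_eq_right.2 hST]
  have e2 : ∑ j ∈ T, γ j ^ 2 = ∑ j ∈ S, β j ^ 2 := by
    simp only [hγ, ite_pow, zero_pow two_ne_zero]
    rw [← Finset.sum_filter, Finset.filter_mem_eq_inter, Finset.inter_eq_right.2 hST]
  have l1 := sMin_mul_norm_le (colSubmatrix (colMatrix X) T) (WithLp.toLp 2 fun j : T => γ j)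
  have l2 := norm_toEuclideanLin_le_sMax (colSubmatrix (colMatrix X) T)
    (WithLp.toLp 2 fun j : T => γ j)
  have e3 : ‖WithLp.toLp 2 (fun j : T => γ j)‖ = √(∑ j ∈ S, β j ^ 2) := by
    rw [EuclideanSpace.norm_eq, ← e2, ← Finset.sum_coe_sort T]
    simp
  rw [toEuclideanLin_colSubmatrix, e1, e3] at l1 l2
  have hs : 0 ≤ ∑ j ∈ S, β j ^ 2 := Finset.sum_nonneg fun _ _ => sq_nonneg _
  have h3 : √(n : ℝ) * (1 - δ) * √(∑ j ∈ S, β j ^ 2) ≤ ‖∑ j ∈ S, β j • X j‖ := by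
    refine le_trans (mul_le_mul_of_nonneg_right (le_trans ?_ h1) (Real.sqrt_nonneg _)) l1
    gcongr
  have h4 : ‖∑ j ∈ S, β j • X j‖ ≤ √(n : ℝ) * (1 + δ) * √(∑ j ∈ S, β j ^ 2) := by
    refine l2.trans (mul_le_mul_of_nonneg_right (h2.trans ?_) (Real.sqrt_nonneg _))
    gcongr
  have hn : (0 : ℝ) ≤ n := Nat.cast_nonneg n
  constructor
  · calc (1 - δ) ^ 2 * n * ∑ j ∈ S, β j ^ 2
        = (√(n : ℝ) * (1 - δ) * √(∑ j ∈ S, β j ^ 2)) ^ 2 := by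
          rw [mul_pow, mul_pow, Real.sq_sqrt hn, Real.sq_sqrt hs]; ring
      _ ≤ _ := by
          have : 0 ≤ 1 - δ := by linarith
          gcongr
  · calc ‖∑ j ∈ S, β j • X j‖ ^ 2 ≤ (√(n : ℝ) * (1 + δ) * √(∑ j ∈ S, β j ^ 2)) ^ 2 := by
          gcongr
      _ = _ := by rw [mul_pow, mul_pow, Real.sq_sqrt hn, Real.sq_sqrt hs]; ring

/-- The vectors `X j` span: every `v` has coefficients of Euclidean norm at most `‖v‖ / s`, where
`s` is a lower bound on the smallest singular value of the transpose. -/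
theorem exists_coeff_of_le_sqrt_sum_inner_sq {s : ℝ} (hs : 0 < s)
    (h : ∀ w, s * ‖w‖ ≤ √(∑ j, inner ℝ (X j) w ^ 2)) (v : EuclideanSpace ℝ (Fin n)) :
    ∃ β : Fin N → ℝ, v = ∑ j, β j • X j ∧ √(∑ j, β j ^ 2) ≤ ‖v‖ / s := by
  -- `T = A Aᵀ` is injective, hence onto. For `v = T w` the coefficients `Aᵀ w` satisfy `‖Aᵀ w‖² =
  -- ⟨T w, w⟩ ≤ ‖v‖ ‖w‖` and `s ‖w‖ ≤ ‖Aᵀ w‖`.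
  let T : EuclideanSpace ℝ (Fin n) →ₗ[ℝ] EuclideanSpace ℝ (Fin n) :=
    ∑ j, (innerₗ (EuclideanSpace ℝ (Fin n)) (X j)).smulRight (X j)
  have hT : ∀ w, T w = ∑ j, inner ℝ (X j) w • X j := fun w => by
    simp [T, LinearMap.sum_apply]
  have hTw : ∀ w, inner ℝ (T w) w = ∑ j, inner ℝ (X j) w ^ 2 := fun w => by
    rw [hT, sum_inner]
    exact Finset.sum_congr rfl fun j _ => by rw [real_inner_smul_left, sq]
  have hinj : Function.Injective T := by
    rw [← LinearMap.ker_eq_bot, LinearMap.ker_eq_bot']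
    intro w hw
    have := h w
    rw [← hTw, hw, inner_zero_left, Real.sqrt_zero] at this
    have h0 : ‖w‖ ≤ 0 := by
      by_contra! hlt
      exact absurd this (not_le.2 (mul_pos hs hlt))
    exact norm_le_zero_iff.1 h0
  obtain ⟨w, rfl⟩ := (LinearMap.injective_iff_surjective.1 hinj) v
  refine ⟨fun j => inner ℝ (X j) w, hT w, ?_⟩
  rw [le_div_iff₀ hs]
  set r := √(∑ j, inner ℝ (X j) w ^ 2) with hr
  have h1 : r * r ≤ ‖T w‖ * ‖w‖ := by
    rw [hr, Real.mul_self_sqrt (Finset.sum_nonneg fun _ _ => sq_nonneg _), ← hTw]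
    exact real_inner_le_norm _ _
  have h2 := h w
  rw [← hr] at h2
  obtain h0 | h0 : 0 = r ∨ 0 < r := (Real.sqrt_nonneg _).eq_or_lt
  · rw [← h0]; simp
  · refine le_of_mul_le_mul_right ?_ h0
    calc r * s * r = r * r * s := by ring
      _ ≤ ‖T w‖ * ‖w‖ * s := by gcongr
      _ = ‖T w‖ * (s * ‖w‖) := by ring
      _ ≤ ‖T w‖ * r := by gcongr

end SingularValues

end GaussianPolytope

/-! ### Random signs -/

namespace GaussianPolytope

section Signs

variable {k : ℕ}

theorem signExp_mono {f g : (Fin k → ℤˣ) → ℝ} (h : ∀ σ, f σ ≤ g σ) : signExp f ≤ signExp g := by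
  unfold signExp
  gcongr with σ
  exact h σ

theorem signExp_nonneg {f : (Fin k → ℤˣ) → ℝ} (h : ∀ σ, 0 ≤ f σ) : 0 ≤ signExp f :=
  div_nonneg (Finset.sum_nonneg fun σ _ => h σ) (by positivity)

theorem signExp_add (f g : (Fin k → ℤˣ) → ℝ) :
    signExp (fun σ => f σ + g σ) = signExp f + signExp g := by
  simp only [signExp, Finset.sum_add_distrib, add_div]

theorem signExp_const_mul (a : ℝ) (f : (Fin k → ℤˣ) → ℝ) :
    signExp (fun σ => a * f σ) = a * signExp f := by
  simp only [signExp, ← Finset.mul_sum, mul_div_assoc]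

theorem signExp_sum {ι : Type*} (s : Finset ι) (f : ι → (Fin k → ℤˣ) → ℝ) :
    signExp (fun σ => ∑ j ∈ s, f j σ) = ∑ j ∈ s, signExp (f j) := by
  simp only [signExp, Finset.sum_div]
  exact Finset.sum_comm

theorem signExp_const (a : ℝ) : signExp (fun _ : Fin k → ℤˣ => a) = a := by
  simp [signExp, Fintype.card_units_int]

theorem signProb_eq_signExp (S : Set (Fin k → ℤˣ)) [DecidablePred (· ∈ S)] :
    signProb S = signExp (fun σ => if σ ∈ S then 1 else 0) := by
  simp only [signProb, signExp, Finset.sum_boole]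
  rw [Set.ncard_eq_toFinset_card' S, Set.toFinset_card, Fintype.card_subtype]

/-- Cauchy-Schwarz inequality for the uniform distribution on signs. -/
theorem signExp_mul_sq_le (f g : (Fin k → ℤˣ) → ℝ) :
    signExp (fun σ => f σ * g σ) ^ 2 ≤
      signExp (fun σ => f σ ^ 2) * signExp (fun σ => g σ ^ 2) := by
  simp only [signExp]
  rw [div_pow, div_mul_div_comm, ← sq]
  gcongr
  exact Finset.sum_mul_sq_le_sq_mul_sq _ _ _

theorem sign_mul_self (s : ℤˣ) : ((s : ℤ) : ℝ) * ((s : ℤ) : ℝ) = 1 := by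
  rcases Int.units_eq_one_or s with h | h <;> simp [h]

theorem signExp_sign_mul_sign (i l : Fin k) :
    signExp (fun σ => (((σ i : ℤˣ) : ℤ) : ℝ) * (((σ l : ℤˣ) : ℤ) : ℝ)) =
      if i = l then 1 else 0 := by
  split_ifs with h
  · subst h
    simp only [sign_mul_self, signExp_const]
  -- Flipping the sign `σ i` preserves the uniform measure and negates the product.
  · have := Equiv.sum_comp (Equiv.mulLeft (Pi.mulSingle i (-1 : ℤˣ)))
      (fun σ : Fin k → ℤˣ => (((σ i : ℤˣ) : ℤ) : ℝ) * (((σ l : ℤˣ) : ℤ) : ℝ))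
    simp only [Equiv.coe_mulLeft, Pi.mul_apply, Pi.mulSingle_eq_same,
      Pi.mulSingle_eq_of_ne (Ne.symm h), one_mul, neg_mul, Units.val_neg, Int.cast_neg,
      Finset.sum_neg_distrib] at this
    rw [signExp, show (∑ σ : Fin k → ℤˣ, (((σ i : ℤˣ) : ℤ) : ℝ) * (((σ l : ℤˣ) : ℤ) : ℝ)) = 0 by
      linarith, zero_div]

/-- Bessel's inequality for the orthonormal system of the signs. -/
theorem sum_signExp_sign_mul_sq_le (f : (Fin k → ℤˣ) → ℝ) :
    ∑ i, signExp (fun σ => (((σ i : ℤˣ) : ℤ) : ℝ) * f σ) ^ 2 ≤ signExp (fun σ => f σ ^ 2) := by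
  set a : Fin k → ℝ := fun i => signExp (fun σ => (((σ i : ℤˣ) : ℤ) : ℝ) * f σ) with ha
  -- The residual of `f` after projection onto the signs has nonnegative second moment.
  have h : 0 ≤ signExp (fun σ => (f σ - ∑ i, a i * (((σ i : ℤˣ) : ℤ) : ℝ)) ^ 2) :=
    signExp_nonneg fun σ => sq_nonneg _
  have e : signExp (fun σ => (f σ - ∑ i, a i * (((σ i : ℤˣ) : ℤ) : ℝ)) ^ 2) =
      signExp (fun σ => f σ ^ 2) - ∑ i, a i ^ 2 := by
    have e1 : (fun σ : Fin k → ℤˣ => (f σ - ∑ i, a i * (((σ i : ℤˣ) : ℤ) : ℝ)) ^ 2) =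
        fun σ => (f σ ^ 2 + (-2) * ∑ i, a i * ((((σ i : ℤˣ) : ℤ) : ℝ) * f σ)) +
          ∑ i, ∑ l, (a i * a l) * ((((σ i : ℤˣ) : ℤ) : ℝ) * (((σ l : ℤˣ) : ℤ) : ℝ)) := by
      funext σ
      have h1 : ∑ i, a i * ((((σ i : ℤˣ) : ℤ) : ℝ) * f σ) =
          (∑ i, a i * (((σ i : ℤˣ) : ℤ) : ℝ)) * f σ := by
        rw [Finset.sum_mul]
        exact Finset.sum_congr rfl fun i _ => by ring
      have h2 : ∑ i, ∑ l, (a i * a l) * ((((σ i : ℤˣ) : ℤ) : ℝ) * (((σ l : ℤˣ) : ℤ) : ℝ)) =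
          (∑ i, a i * (((σ i : ℤˣ) : ℤ) : ℝ)) ^ 2 := by
        rw [sq, Finset.sum_mul_sum]
        exact Finset.sum_congr rfl fun i _ => Finset.sum_congr rfl fun l _ => by ring
      rw [h1, h2]
      ring
    rw [e1, signExp_add, signExp_add, signExp_const_mul, signExp_sum, signExp_sum]
    simp only [signExp_sum, signExp_const_mul, signExp_sign_mul_sign, mul_ite, mul_one, mul_zero,
      Finset.sum_ite_eq, Finset.mem_univ, if_true]
    have : ∀ i, signExp (fun σ => (((σ i : ℤˣ) : ℤ) : ℝ) * f σ) = a i := fun i => rfl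
    simp only [this, ← sq]
    ring
  linarith

theorem sum_abs_signExp_sign_mul_le (f : (Fin k → ℤˣ) → ℝ) :
    ∑ i, |signExp (fun σ => (((σ i : ℤˣ) : ℤ) : ℝ) * f σ)| ≤
      √k * √(signExp (fun σ => f σ ^ 2)) := by
  rw [← Real.sqrt_mul (Nat.cast_nonneg k)]
  refine Real.le_sqrt_of_sq_le ((sq_sum_le_card_mul_sum_sq).trans ?_)
  simp only [sq_abs, Finset.card_univ, Fintype.card_fin]
  gcongr
  exact sum_signExp_sign_mul_sq_le f

/-- Summing the previous bound over a family of functions. -/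
theorem sum_sum_abs_signExp_sign_mul_le {ι : Type*} (s : Finset ι) (f : ι → (Fin k → ℤˣ) → ℝ) :
    ∑ j ∈ s, ∑ i, |signExp (fun σ => (((σ i : ℤˣ) : ℤ) : ℝ) * f j σ)| ≤
      √k * √(s.card * signExp (fun σ => ∑ j ∈ s, f j σ ^ 2)) := by
  calc ∑ j ∈ s, ∑ i, |signExp (fun σ => (((σ i : ℤˣ) : ℤ) : ℝ) * f j σ)|
      ≤ ∑ j ∈ s, √k * √(signExp (fun σ => f j σ ^ 2)) :=
        Finset.sum_le_sum fun j _ => sum_abs_signExp_sign_mul_le (f j)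
    _ = √k * ∑ j ∈ s, √(signExp (fun σ => f j σ ^ 2)) := by rw [Finset.mul_sum]
    _ ≤ _ := by
        gcongr
        refine Real.le_sqrt_of_sq_le ((sq_sum_le_card_mul_sum_sq).trans ?_)
        rw [signExp_sum]
        gcongr with j
        rw [Real.sq_sqrt (signExp_nonneg fun σ => sq_nonneg _)]

theorem sum_abs_signExp_sign_mul_le_card_mul (f : (Fin k → ℤˣ) → ℝ) :
    ∑ i, |signExp (fun σ => (((σ i : ℤˣ) : ℤ) : ℝ) * f σ)| ≤ k * signExp (fun σ => |f σ|) := by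
  have h : ∀ i : Fin k, |signExp (fun σ => (((σ i : ℤˣ) : ℤ) : ℝ) * f σ)| ≤
      signExp (fun σ => |f σ|) := fun i => by
    simp only [signExp]
    rw [abs_div, abs_of_pos (by positivity : (0 : ℝ) < 2 ^ k)]
    gcongr
    refine (Finset.abs_sum_le_sum_abs _ _).trans (Finset.sum_le_sum fun σ _ => ?_)
    rw [abs_mul]
    rcases Int.units_eq_one_or (σ i) with h | h <;> simp [h]
  refine (Finset.sum_le_sum fun i _ => h i).trans ?_
  simp

/-! ### Second and fourth moments of the norm of a random sign combination. -/

variable {n : ℕ}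

theorem signExp_norm_signSum_sq (y : Fin k → EuclideanSpace ℝ (Fin n)) (hy : ∀ i, ‖y i‖ = 1) :
    signExp (fun σ => ‖signSum y σ‖ ^ 2) = k := by
  have e : (fun σ : Fin k → ℤˣ => ‖signSum y σ‖ ^ 2) = fun σ =>
      ∑ i, ∑ l, inner ℝ (y i) (y l) * ((((σ i : ℤˣ) : ℤ) : ℝ) * (((σ l : ℤˣ) : ℤ) : ℝ)) := by
    funext σ
    rw [← real_inner_self_eq_norm_sq, signSum, sum_inner]
    simp only [inner_sum, real_inner_smul_left, real_inner_smul_right]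
    exact Finset.sum_congr rfl fun i _ => Finset.sum_congr rfl fun l _ => by ring
  rw [e, signExp_sum]
  simp only [signExp_sum, signExp_const_mul, signExp_sign_mul_sign, mul_ite, mul_one, mul_zero,
    Finset.sum_ite_eq, Finset.mem_univ, if_true, real_inner_self_eq_norm_sq, hy, one_pow,
    Finset.sum_const, Finset.card_univ, Fintype.card_fin, nsmul_eq_mul]

theorem signExp_succ (f : (Fin (k + 1) → ℤˣ) → ℝ) :
    signExp f = signExp (fun σ : Fin k → ℤˣ =>
      (f (Fin.cons 1 σ) + f (Fin.cons (-1) σ)) / 2) := by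
  simp only [signExp]
  rw [← Equiv.sum_comp (Fin.consEquiv fun _ => ℤˣ), Fintype.sum_prod_type_right]
  have : ∀ g : ℤˣ → ℝ, ∑ s, g s = g 1 + g (-1) := fun g => by
    rw [show (Finset.univ : Finset ℤˣ) = {1, -1} from rfl, Finset.sum_pair (by decide)]
  simp only [this, Fin.consEquiv, Equiv.coe_fn_mk, ← Finset.sum_div]
  rw [div_div, pow_succ']

/-- Induction on `k`: averaging over one sign cancels the odd cross terms, so the moment grows by at
most `6k + 1 ≤ 3(k + 1)² - 3k²`. -/
theorem signExp_norm_signSum_pow_four_le :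
    ∀ {k : ℕ} (y : Fin k → EuclideanSpace ℝ (Fin n)), (∀ i, ‖y i‖ = 1) →
      signExp (fun σ => ‖signSum y σ‖ ^ 4) ≤ 3 * (k : ℝ) ^ 2
  | 0, y, _ => by simp [signSum, signExp]
  | k + 1, y, hy => by
    have ih := signExp_norm_signSum_pow_four_le (fun i => y i.succ) fun i => hy _
    have h2 := signExp_norm_signSum_sq (fun i => y i.succ) fun i => hy _
    rw [signExp_succ]
    have h : ∀ σ : Fin k → ℤˣ,
        (‖signSum y (Fin.cons 1 σ)‖ ^ 4 + ‖signSum y (Fin.cons (-1) σ)‖ ^ 4) / 2 ≤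
          (‖signSum (fun i => y i.succ) σ‖ ^ 4 + 6 * ‖signSum (fun i => y i.succ) σ‖ ^ 2) + 1 := by
      intro σ
      set Y := signSum (fun i => y i.succ) σ with hY
      have e1 : signSum y (Fin.cons 1 σ) = Y + y 0 := by
        simp [signSum, Fin.sum_univ_succ, hY, add_comm]
      have e2 : signSum y (Fin.cons (-1) σ) = Y - y 0 := by
        simp [signSum, Fin.sum_univ_succ, hY, sub_eq_add_neg, add_comm]
      have f1 := norm_add_sq_real Y (y 0)
      have f2 := norm_sub_sq_real Y (y 0)
      rw [hy 0] at f1 f2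
      have f3 : inner ℝ Y (y 0) ^ 2 ≤ ‖Y‖ ^ 2 := by
        have := abs_real_inner_le_norm Y (y 0)
        rw [hy 0, mul_one] at this
        exact sq_le_sq' (by linarith [(abs_le.1 this).1]) (abs_le.1 this).2
      rw [e1, e2, show ‖Y + y 0‖ ^ 4 = (‖Y + y 0‖ ^ 2) ^ 2 by ring,
        show ‖Y - y 0‖ ^ 4 = (‖Y - y 0‖ ^ 2) ^ 2 by ring, f1, f2]
      nlinarith
    refine (signExp_mono h).trans ?_
    rw [signExp_add, signExp_add, signExp_const_mul, signExp_const, h2]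
    push_cast
    nlinarith

end Signs

end GaussianPolytope

/-! ### The norm with unit ball `conv {± X j}` -/

namespace GaussianPolytope

section PolyNorm

variable {N n : ℕ} {X : Fin N → EuclideanSpace ℝ (Fin n)}

theorem sum_smul_mem_polytope (X : Fin N → EuclideanSpace ℝ (Fin n)) (h0 : 0 < N)
    {β : Fin N → ℝ} (hβ : ∑ j, |β j| ≤ 1) : ∑ j, β j • X j ∈ polytope X := by
  have hc : Convex ℝ (polytope X) := convex_convexHull ℝ _
  have hp : ∀ j, X j ∈ polytope X := fun j => subset_convexHull ℝ _ (Or.inl ⟨j, rfl⟩)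
  have hm : ∀ j, -X j ∈ polytope X := fun j => subset_convexHull ℝ _ (Or.inr ⟨j, rfl⟩)
  have hz : (0 : EuclideanSpace ℝ (Fin n)) ∈ polytope X := by
    have := hc (hp ⟨0, h0⟩) (hm ⟨0, h0⟩) (a := 1 / 2) (b := 1 / 2) (by norm_num) (by norm_num)
      (by norm_num)
    simpa using this
  have hs : ∀ j, (if 0 ≤ β j then X j else -X j) ∈ polytope X := fun j => by
    split_ifs
    exacts [hp j, hm j]
  have he : ∑ j, β j • X j = ∑ j, |β j| • (if 0 ≤ β j then X j else -X j) :=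
    Finset.sum_congr rfl fun j _ => by
      split_ifs with h
      · rw [abs_of_nonneg h]
      · rw [abs_of_neg (not_le.1 h), smul_neg, neg_smul, neg_neg]
  rw [he]
  set s := ∑ j, |β j| with hsdef
  obtain h | h : 0 = s ∨ 0 < s := (Finset.sum_nonneg fun _ _ => abs_nonneg _ : 0 ≤ s).eq_or_lt
  · have : ∀ j, |β j| = 0 := fun j =>
      (Finset.sum_eq_zero_iff_of_nonneg fun _ _ => abs_nonneg _).1 h.symm j (Finset.mem_univ j)
    simpa [this] using hz
  · have h1 : ∑ j, (|β j| / s) • (if 0 ≤ β j then X j else -X j) ∈ polytope X :=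
      hc.sum_mem (fun j _ => by positivity) (by rw [← Finset.sum_div, div_self h.ne'])
        fun j _ => hs j
    have h2 := hc.smul_mem_of_zero_mem hz h1 ⟨h.le, hβ⟩
    rw [Finset.smul_sum] at h2
    convert h2 using 2 with j
    rw [smul_smul, mul_div_cancel₀ _ h.ne']

theorem exists_coeff_of_mem_polytope {v : EuclideanSpace ℝ (Fin n)} (hv : v ∈ polytope X) :
    ∃ β : Fin N → ℝ, v = ∑ j, β j • X j ∧ ∑ j, |β j| ≤ 1 := by
  let S : Set (EuclideanSpace ℝ (Fin n)) :=
    {v | ∃ β : Fin N → ℝ, v = ∑ j, β j • X j ∧ ∑ j, |β j| ≤ 1}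
  have hS : Convex ℝ S := by
    rintro _ ⟨β, rfl, hβ⟩ _ ⟨γ, rfl, hγ⟩ a b ha hb hab
    refine ⟨fun j => a * β j + b * γ j, ?_, ?_⟩
    · simp only [Finset.smul_sum, add_smul, mul_smul, Finset.sum_add_distrib]
    · calc ∑ j, |a * β j + b * γ j| ≤ ∑ j, (a * |β j| + b * |γ j|) :=
            Finset.sum_le_sum fun j _ => (abs_add_le _ _).trans_eq (by
              rw [abs_mul, abs_mul, abs_of_nonneg ha, abs_of_nonneg hb])
        _ = a * ∑ j, |β j| + b * ∑ j, |γ j| := by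
            rw [Finset.sum_add_distrib, Finset.mul_sum, Finset.mul_sum]
        _ ≤ a * 1 + b * 1 := by gcongr
        _ = 1 := by linarith
  refine convexHull_min ?_ hS hv
  rintro _ (⟨j, rfl⟩ | ⟨j, rfl⟩)
  · refine ⟨Pi.single j 1, ?_, ?_⟩
    · simp [Pi.single_apply]
    · simp [Pi.single_apply, apply_ite abs]
  · refine ⟨Pi.single j (-1), ?_, ?_⟩
    · simp [Pi.single_apply, ite_smul]
    · simp [Pi.single_apply, apply_ite abs]

theorem polyNorm_sum_smul_le (X : Fin N → EuclideanSpace ℝ (Fin n)) (h0 : 0 < N)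
    (β : Fin N → ℝ) : polyNorm X (∑ j, β j • X j) ≤ ∑ j, |β j| := by
  set s := ∑ j, |β j| with hs
  have hs0 : 0 ≤ s := Finset.sum_nonneg fun _ _ => abs_nonneg _
  refine le_of_forall_pos_le_add fun ε hε => ?_
  refine gauge_le_of_mem (by positivity) ?_
  have hpos : 0 < s + ε := by positivity
  refine ⟨∑ j, (β j / (s + ε)) • X j, sum_smul_mem_polytope X h0 ?_, ?_⟩
  · simp only [abs_div, abs_of_pos hpos]
    rw [← Finset.sum_div, ← hs, div_le_one hpos]
    linarith
  · change (s + ε) • ∑ j, (β j / (s + ε)) • X j = _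
    rw [Finset.smul_sum]
    exact Finset.sum_congr rfl fun j _ => by rw [smul_smul, mul_div_cancel₀ _ hpos.ne']

/-- If the `X j` span the space, then the polytope norm is the least `ℓ₁` norm of a coefficient
vector, and this minimum is attained. -/
theorem exists_coeff_sum_abs_eq_polyNorm (h0 : 0 < N)
    (hspan : ∀ v, ∃ β : Fin N → ℝ, v = ∑ j, β j • X j) (v : EuclideanSpace ℝ (Fin n)) :
    ∃ β : Fin N → ℝ, v = ∑ j, β j • X j ∧ ∑ j, |β j| = polyNorm X v := by
  have hcomp : IsCompact (polytope X) :=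
    ((Set.finite_range _).union (Set.finite_range _)).isCompact_convexHull (𝕜 := ℝ)
  have hc : Convex ℝ (polytope X) := convex_convexHull ℝ _
  have hz : (0 : EuclideanSpace ℝ (Fin n)) ∈ polytope X := by
    simpa using sum_smul_mem_polytope X h0 (β := 0) (by simp)
  have habs : Absorbent ℝ (polytope X) := by
    intro w
    obtain ⟨β, hβ⟩ := hspan w
    refine Absorbs.of_norm ⟨∑ j, |β j| + 1, fun a ha => ?_⟩
    have hs0 : 0 ≤ ∑ j, |β j| := Finset.sum_nonneg fun _ _ => abs_nonneg _
    have ha0 : 0 < ‖a‖ := by linarith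
    have ha' : a ≠ 0 := norm_pos_iff.1 ha0
    rw [Set.singleton_subset_iff]
    refine ⟨∑ j, (β j / a) • X j, sum_smul_mem_polytope X h0 ?_, ?_⟩
    · simp only [abs_div]
      rw [← Finset.sum_div, ← Real.norm_eq_abs a, div_le_one ha0]
      linarith
    · change a • ∑ j, (β j / a) • X j = _
      rw [Finset.smul_sum, hβ]
      exact Finset.sum_congr rfl fun j _ => by rw [smul_smul, mul_div_cancel₀ _ ha']
  have hb : Bornology.IsVonNBounded ℝ (polytope X) :=
    NormedSpace.isVonNBounded_of_isBounded ℝ hcomp.isBounded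
  have hle : ∃ β : Fin N → ℝ, v = ∑ j, β j • X j ∧ ∑ j, |β j| ≤ polyNorm X v := by
    set g := polyNorm X v with hg
    obtain h | h : 0 = g ∨ 0 < g := (gauge_nonneg v).eq_or_lt
    · have hv : v = 0 := (gauge_eq_zero habs hb).1 h.symm
      exact ⟨0, by simp [hv], by simp [← h]⟩
    · have h1 : gauge (polytope X) (g⁻¹ • v) ≤ 1 := by
        rw [gauge_smul_of_nonneg (inv_nonneg.2 h.le), smul_eq_mul]
        exact (inv_mul_cancel₀ h.ne').le
      have h2 := mem_closure_of_gauge_le_one hc hz habs h1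
      -- The polytope is closed, so the minimum defining the norm is attained.
      rw [hcomp.isClosed.closure_eq] at h2
      obtain ⟨β, hβ, hβ1⟩ := exists_coeff_of_mem_polytope h2
      refine ⟨fun j => g * β j, ?_, ?_⟩
      · simp only [mul_smul]
        rw [← Finset.smul_sum, ← hβ, smul_smul, mul_inv_cancel₀ h.ne', one_smul]
      · simp only [abs_mul, abs_of_pos h]
        rw [← Finset.mul_sum]
        exact mul_le_of_le_one_right h.le hβ1
  obtain ⟨β, hβ, hβ1⟩ := hle
  refine ⟨β, hβ, le_antisymm hβ1 ?_⟩
  conv_lhs => rw [hβ]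
  exact polyNorm_sum_smul_le X h0 β

end PolyNorm

end GaussianPolytope

/-! ### Euclidean norms of coefficient vectors -/

namespace GaussianPolytope

section Coefficients

variable {N n : ℕ} {X : Fin N → EuclideanSpace ℝ (Fin n)} {c : ℝ}

theorem sqrt_mul_log_inv_le_half {x : ℝ} (hx0 : 0 < x) (hx : x ≤ 1 / 100) :
    √x * Real.log x⁻¹ ≤ 1 / 2 := by
  have hs : 0 < √x := Real.sqrt_pos.2 hx0
  have hs1 : √x ≤ 1 / 10 := by
    rw [Real.sqrt_le_left (by norm_num)]
    linarith
  -- apply `log y ≤ y - 1` to the fourth root of `x⁻¹`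
  set w := √(√x) with hw
  have hw0 : 0 < w := Real.sqrt_pos.2 hs
  have hw2 : w ^ 2 = √x := Real.sq_sqrt hs.le
  have hx4 : x = w ^ 4 := by
    rw [show w ^ 4 = (w ^ 2) ^ 2 by ring, hw2, Real.sq_sqrt hx0.le]
  -- The divisor 3 puts the tangent point near the fourth root of 100, where the estimate is
  -- tightest.
  have hlog : Real.log x⁻¹ = 4 * Real.log (w⁻¹ / 3) + 4 * Real.log 3 := by
    rw [Real.log_div (by positivity) (by norm_num), hx4, ← inv_pow, Real.log_pow]
    push_cast
    ring
  have h1 : Real.log (w⁻¹ / 3) ≤ w⁻¹ / 3 - 1 := Real.log_le_sub_one_of_pos (by positivity)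
  have h3 : Real.log 3 ≤ 1.1 := by
    have := Real.log_three_lt_d9
    linarith
  have h4 : Real.log x⁻¹ ≤ 4 / 3 * w⁻¹ + 2 / 5 := by linarith
  have hw1 : w ≤ 8 / 25 := by
    refine (pow_le_pow_iff_left₀ hw0.le (by norm_num) two_ne_zero).1 ?_
    rw [hw2]
    linarith
  calc √x * Real.log x⁻¹ ≤ w ^ 2 * (4 / 3 * w⁻¹ + 2 / 5) := by rw [hw2]; gcongr
    _ = 4 / 3 * w + 2 / 5 * w ^ 2 := by field_simp
    _ ≤ 1 / 2 := by nlinarith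

/-- Coefficients exceeding `τ` in absolute value are at most `‖β‖₁ / τ` in number. -/
theorem card_mul_le_sum_abs {ι : Type*} [Fintype ι] (β : ι → ℝ) {τ : ℝ} {J : Finset ι}
    (hJ : ∀ j ∈ J, τ ≤ |β j|) : J.card * τ ≤ ∑ j, |β j| := by
  rw [← nsmul_eq_mul]
  exact (Finset.card_nsmul_le_sum _ _ _ hJ).trans
    (Finset.sum_le_sum_of_subset_of_nonneg (Finset.subset_univ _) fun _ _ _ => abs_nonneg _)

theorem sum_sq_le_mul_sum_abs {ι : Type*} [Fintype ι] (β : ι → ℝ) {τ : ℝ} (hτ : 0 ≤ τ)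
    {S : Finset ι} (hS : ∀ j ∈ S, |β j| ≤ τ) : ∑ j ∈ S, β j ^ 2 ≤ τ * ∑ j, |β j| := by
  calc ∑ j ∈ S, β j ^ 2 ≤ ∑ j ∈ S, τ * |β j| := Finset.sum_le_sum fun j hj => by
        rw [← sq_abs, sq]
        exact mul_le_mul_of_nonneg_right (hS j hj) (abs_nonneg _)
    _ ≤ ∑ j, τ * |β j| :=
        Finset.sum_le_sum_of_subset_of_nonneg (Finset.subset_univ _) fun _ _ _ => by positivity
    _ = _ := by rw [Finset.mul_sum]

/-- With `m` about `c n`, fewer than `m` or exactly `m` coefficients exceed `‖β‖₁ / m`. The rest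
have Euclidean norm at most `‖β‖₁ / √m`, and by the bound on `‖A‖` they change `∑ β_j X_j` by a
multiple of `‖β‖₁`. The large ones are then recovered from restricted isometry with `δ = 1 / 2`. -/
theorem sqrt_sum_sq_coeff_le (hX : X ∈ sparseSingularValuesEvent N n c) (hc0 : 0 < c)
    (hc : c ≤ 1 / 100) (hcn : c⁻¹ ≤ n) (hnN : n ≤ N) {K' : ℝ} (hK' : (N : ℝ) ≤ K' * n)
    (β : Fin N → ℝ) :
    √(∑ j, β j ^ 2) ≤
      (2 * ‖∑ j, β j • X j‖ + (8 * √(2 * K' / c) + √(2 / c)) * ∑ j, |β j|) / √(n : ℝ) := by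
  have hn0 : (0 : ℝ) < n := (inv_pos.2 hc0).trans_le hcn
  have hcn1 : 1 ≤ c * n := by
    have := mul_le_mul_of_nonneg_left hcn hc0.le
    rwa [mul_inv_cancel₀ hc0.ne'] at this
  set l := ∑ j, |β j| with hl
  have hl0 : 0 ≤ l := Finset.sum_nonneg fun _ _ => abs_nonneg _
  set m := ⌊c * n⌋₊ with hm
  have hm1 : 1 ≤ m := Nat.le_floor (by exact_mod_cast hcn1)
  have hm0 : (0 : ℝ) < m := by exact_mod_cast hm1
  have hmc : (m : ℝ) ≤ c * n := Nat.floor_le (by positivity)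
  have hm2 : c * n / 2 ≤ m := by
    have h1 : c * n < m + 1 := Nat.lt_floor_add_one _
    have h2 : (1 : ℝ) ≤ m := by exact_mod_cast hm1
    linarith
  have hmn : (m : ℝ) / n ≤ 1 / 100 := by
    rw [div_le_iff₀ hn0]
    nlinarith
  have hmN : m ≤ N := by
    have : (m : ℝ) ≤ N := by
      have : (n : ℝ) ≤ N := by exact_mod_cast hnN
      nlinarith
    exact_mod_cast this
  have hR : RestrictedIsometry X n (1 / 2) m := by
    refine restrictedIsometry hX hm1 hmc hmN ?_ (by norm_num)
    rw [← inv_div (m : ℝ) n]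
    exact sqrt_mul_log_inv_le_half (by positivity) hmn
  set J := Finset.univ.filter fun j => l / m < |β j| with hJ
  have hJm : J.card ≤ m := by
    by_contra! hlt
    obtain ⟨S, hSJ, hS⟩ := Finset.exists_subset_card_eq hlt.le
    have h1 : ∑ j ∈ S, l / m < ∑ j ∈ S, |β j| :=
      Finset.sum_lt_sum_of_nonempty (Finset.card_pos.1 (hS ▸ hm1)) fun j hj =>
        (Finset.mem_filter.1 (hSJ hj)).2
    have h2 : ∑ j ∈ S, |β j| ≤ l :=
      Finset.sum_le_sum_of_subset_of_nonneg (Finset.subset_univ _) fun _ _ _ => abs_nonneg _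
    rw [Finset.sum_const, hS, nsmul_eq_mul, mul_div_cancel₀ _ hm0.ne'] at h1
    linarith
  have hsmall : √(∑ j ∈ Jᶜ, β j ^ 2) ≤ √(2 / c) * l / √(n : ℝ) := by
    have h1 : ∑ j ∈ Jᶜ, β j ^ 2 ≤ l / m * l :=
      sum_sq_le_mul_sum_abs β (by positivity) fun j hj => by
        simpa [hJ] using hj
    rw [show √(2 / c) * l / √(n : ℝ) = √(2 / c / n) * l by
      rw [Real.sqrt_div' _ hn0.le]; ring]
    refine Real.sqrt_le_iff.2 ⟨by positivity, h1.trans ?_⟩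
    rw [mul_pow, Real.sq_sqrt (by positivity), sq, ← mul_assoc]
    gcongr
    rw [div_le_iff₀ hm0]
    calc l = 2 / c / n * l * (c * n / 2) := by field_simp
      _ ≤ _ := by gcongr
  have hNn : √(N : ℝ) * (√(2 / c) * l / √(n : ℝ)) ≤ √(2 * K' / c) * l := by
    have hK0 : 0 ≤ K' := by
      by_contra! hlt
      have : K' * n < 0 := mul_neg_of_neg_of_pos hlt hn0
      have : (0 : ℝ) ≤ N := Nat.cast_nonneg N
      linarith
    calc √(N : ℝ) * (√(2 / c) * l / √(n : ℝ)) ≤ √(K' * n) * (√(2 / c) * l / √(n : ℝ)) := by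
          gcongr
      _ = √(2 * K' / c) * l := by
          rw [Real.sqrt_mul hK0, show 2 * K' / c = K' * (2 / c) by ring, Real.sqrt_mul hK0]
          field_simp
  have hbig : √(∑ j ∈ J, β j ^ 2) ≤
      2 * (‖∑ j, β j • X j‖ + 4 * (√(2 * K' / c) * l)) / √(n : ℝ) := by
    have h1 := (hR J hJm β).1
    have h2 : ‖∑ j ∈ Jᶜ, β j • X j‖ ≤ 4 * √(N : ℝ) * √(∑ j ∈ Jᶜ, β j ^ 2) := by
      have := norm_sum_smul_le hX fun j => if j ∈ Jᶜ then β j else 0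
      simpa only [ite_smul, zero_smul, ite_pow, zero_pow two_ne_zero, Finset.sum_ite_mem,
        Finset.univ_inter] using this
    have h3 : ‖∑ j ∈ J, β j • X j‖ ≤ ‖∑ j, β j • X j‖ + ‖∑ j ∈ Jᶜ, β j • X j‖ := by
      rw [← Finset.sum_add_sum_compl J (fun j => β j • X j)]
      simpa using norm_sub_le (∑ j ∈ J, β j • X j + ∑ j ∈ Jᶜ, β j • X j) (∑ j ∈ Jᶜ, β j • X j)
    have h4 : ‖∑ j ∈ J, β j • X j‖ ≤ ‖∑ j, β j • X j‖ + 4 * (√(2 * K' / c) * l) := by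
      have : √(N : ℝ) * √(∑ j ∈ Jᶜ, β j ^ 2) ≤ √(2 * K' / c) * l :=
        (mul_le_mul_of_nonneg_left hsmall (Real.sqrt_nonneg _)).trans hNn
      linarith
    refine Real.sqrt_le_iff.2 ⟨by positivity, ?_⟩
    have h5 := pow_le_pow_left₀ (norm_nonneg _) h4 2
    rw [div_pow, Real.sq_sqrt hn0.le, le_div_iff₀ hn0]
    nlinarith
  calc √(∑ j, β j ^ 2) = √(∑ j ∈ J, β j ^ 2 + ∑ j ∈ Jᶜ, β j ^ 2) := by
        rw [Finset.sum_add_sum_compl]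
    _ ≤ √(∑ j ∈ J, β j ^ 2) + √(∑ j ∈ Jᶜ, β j ^ 2) := by
        refine Real.sqrt_le_iff.2 ⟨by positivity, ?_⟩
        have a1 := Real.sq_sqrt (Finset.sum_nonneg fun j (_ : j ∈ J) => sq_nonneg (β j))
        have a2 := Real.sq_sqrt (Finset.sum_nonneg fun j (_ : j ∈ Jᶜ) => sq_nonneg (β j))
        have : 0 ≤ √(∑ j ∈ J, β j ^ 2) * √(∑ j ∈ Jᶜ, β j ^ 2) := by positivity
        nlinarith
    _ ≤ 2 * (‖∑ j, β j • X j‖ + 4 * (√(2 * K' / c) * l)) / √(n : ℝ) +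
          √(2 / c) * l / √(n : ℝ) := add_le_add hbig hsmall
    _ = _ := by ring

/-- Restricted isometry for sets whose size is comparable with `l * n / u ^ 128`. -/
theorem exists_restrictedIsometry (hX : X ∈ sparseSingularValuesEvent N n c)
    (hc : c ≤ 1 / 100) (hnN : n ≤ N) {C u L l : ℝ} (hC : 0 ≤ C)
    (hu : 1 ≤ u) (hun : u ^ 128 ≤ n) (hL : 1 ≤ L) (hlog : Real.log (u ^ 128) ≤ L)
    (huL : 128 * (C + 1) * L ^ 2 ≤ c * u ^ 3) (hl1 : 1 ≤ l) (hlu : l ≤ (C + 1) * u ^ 125) :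
    ∃ (m : ℕ) (δ : ℝ), 0 < m ∧ l / (u ^ 128 / n) ≤ m ∧ 0 ≤ δ ∧ δ ≤ 1 / 4 ∧
      δ ^ 2 = 4 * l / u ^ 128 * L ^ 2 ∧ RestrictedIsometry X n δ (2 * m) := by
  have hu0 : 0 < u := by linarith
  have hn0 : (0 : ℝ) < n := lt_of_lt_of_le (by positivity) hun
  have hL2 : 1 ≤ L ^ 2 := one_le_pow₀ hL
  set τ := u ^ 128 / n with hτ
  have hτ0 : 0 < τ := by positivity
  have hτ1 : τ ≤ 1 := (div_le_one hn0).2 hun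
  -- At most `l / τ` coefficients of a vector of `ℓ₁` norm at most `l` can reach `τ`.
  set m := ⌈l / τ⌉₊ with hm
  have hlτ : 1 ≤ l / τ := (one_le_div hτ0).2 (hτ1.trans hl1)
  have hml : l / τ ≤ m := Nat.le_ceil _
  have hm2 : (m : ℝ) ≤ 2 * (l / τ) := by
    have := Nat.ceil_lt_add_one (zero_le_one.trans hlτ)
    linarith
  have hm0 : 0 < m := Nat.ceil_pos.2 (by linarith)
  have hm0' : (0 : ℝ) < m := by exact_mod_cast hm0
  have hM : ((2 * m : ℕ) : ℝ) / n ≤ 4 * l / u ^ 128 := by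
    push_cast
    rw [div_le_iff₀ hn0]
    calc (2 : ℝ) * m ≤ 2 * (2 * (l / τ)) := by gcongr
      _ = 4 * l / u ^ 128 * n := by rw [hτ]; field_simp; norm_num
  have hu3 : 4 * (C + 1) ≤ c * u ^ 3 := by
    have : (C + 1) * 1 ≤ (C + 1) * L ^ 2 := by gcongr
    linarith
  have hMc : ((2 * m : ℕ) : ℝ) ≤ c * n := by
    rw [← div_le_iff₀ hn0]
    refine hM.trans ?_
    rw [div_le_iff₀ (by positivity)]
    calc 4 * l ≤ 4 * ((C + 1) * u ^ 125) := by gcongr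
      _ = 4 * (C + 1) * u ^ 125 := by ring
      _ ≤ (c * u ^ 3) * u ^ 125 := mul_le_mul_of_nonneg_right hu3 (by positivity)
      _ = c * u ^ 128 := by ring
  have hδ1 : √(4 * l / u ^ 128) * L ≤ 1 / 4 := by
    refine (pow_le_pow_iff_left₀ (by positivity) (by norm_num) two_ne_zero).1 ?_
    rw [mul_pow, Real.sq_sqrt (by positivity), div_mul_eq_mul_div, div_le_iff₀ (by positivity)]
    calc 4 * l * L ^ 2 ≤ 4 * ((C + 1) * u ^ 125) * L ^ 2 := by gcongr
      _ = 1 / 32 * (128 * (C + 1) * L ^ 2) * u ^ 125 := by ring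
      _ ≤ 1 / 32 * (c * u ^ 3) * u ^ 125 := by gcongr
      _ ≤ 1 / 32 * (1 * u ^ 3) * u ^ 125 := by gcongr; linarith
      _ = 1 / 32 * u ^ 128 := by ring
      _ ≤ (1 / 4) ^ 2 * u ^ 128 := by gcongr; norm_num
  refine ⟨m, √(4 * l / u ^ 128) * L, hm0, hml, by positivity, hδ1, ?_, ?_⟩
  · rw [mul_pow, Real.sq_sqrt (by positivity)]
  · refine restrictedIsometry hX (by omega) hMc ?_ ?_ (by linarith)
    · have h1 : (n : ℝ) ≤ N := by exact_mod_cast hnN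
      have h2 : c * (n : ℝ) ≤ 1 * n := by gcongr; linarith
      have : ((2 * m : ℕ) : ℝ) ≤ N := by linarith
      exact_mod_cast this
    -- Since `l ≥ 1`, `m ≥ n / u ^ 128`: the logarithm depends on `u` only, not on `n`.
    · have h2 : Real.log ((n : ℝ) / (2 * m : ℕ)) ≤ L := by
        refine (Real.log_le_log (by positivity) ?_).trans hlog
        rw [div_le_iff₀ (by positivity)]
        have h3 : (n : ℝ) / u ^ 128 ≤ m := by
          refine le_trans ?_ hml
          rw [hτ, div_div_eq_mul_div]
          gcongr
          exact le_mul_of_one_le_left hn0.le hl1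
        rw [div_le_iff₀ (by positivity)] at h3
        push_cast
        have : 0 ≤ (m : ℝ) * u ^ 128 := by positivity
        linarith
      calc _ ≤ √(((2 * m : ℕ) : ℝ) / n) * L := by gcongr
        _ ≤ _ := by gcongr

/-- The Euclidean mass of the coefficients of `Y = ∑ j, β j • X j` at the vectors `X j` nearly
orthogonal to `Y`. The parameter `u` is a small power of the number of signs. -/
theorem sum_sq_coeff_nearly_orthogonal_le (hX : X ∈ sparseSingularValuesEvent N n c)
    (hc0 : 0 < c) (hc : c ≤ 1 / 100) (hnN : n ≤ N) {C D u L : ℝ} (hC : 0 ≤ C)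
    (hu : 1 ≤ u) (hun : u ^ 128 ≤ n) (hL : 1 ≤ L) (hlog : Real.log (u ^ 128) ≤ L)
    (huL : 128 * (D ^ 2 + C + 1) / c * L ^ 2 ≤ u ^ 3) (β : Fin N → ℝ)
    (hl : ∑ j, |β j| ≤ C * ‖∑ j, β j • X j‖)
    (hβ : ∑ j, β j ^ 2 ≤ D ^ 2 * ‖∑ j, β j • X j‖ ^ 2 / n) :
    ∑ j with |inner ℝ (X j) (∑ i, β i • X i)| ≤ u ^ 125, β j ^ 2 ≤
      (D ^ 2 * ‖∑ j, β j • X j‖ ^ 4 / u ^ 250 + 2 * (max (∑ j, |β j|) 1 * u ^ 128)) / n := by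
  set Y := ∑ j, β j • X j with hY
  set l := ∑ j, |β j| with hldef
  set l' := max l 1 with hl'
  have hl0 : 0 ≤ l := Finset.sum_nonneg fun _ _ => abs_nonneg _
  have hl1 : 1 ≤ l' := le_max_right _ _
  have hll : l ≤ l' := le_max_left _ _
  have hu0 : 0 < u := by linarith
  have hn0 : (0 : ℝ) < n := lt_of_lt_of_le (by positivity) hun
  have hsub : ∀ S : Finset (Fin N), ∑ j ∈ S, β j ^ 2 ≤ ∑ j, β j ^ 2 := fun S =>
    Finset.sum_le_sum_of_subset_of_nonneg (Finset.subset_univ _) fun _ _ _ => sq_nonneg _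
  -- If `‖Y‖` is atypically large, the global bound suffices, at the price of a fourth moment.
  rcases lt_or_ge (u ^ 125) ‖Y‖ with hYu | hYu
  · refine (hsub _).trans (hβ.trans ?_)
    gcongr
    have h1 : ‖Y‖ ^ 2 ≤ ‖Y‖ ^ 4 / u ^ 250 := by
      rw [le_div_iff₀ (by positivity), show ‖Y‖ ^ 4 = ‖Y‖ ^ 2 * ‖Y‖ ^ 2 by ring,
        show u ^ 250 = (u ^ 125) ^ 2 by ring]
      gcongr
    calc D ^ 2 * ‖Y‖ ^ 2 ≤ D ^ 2 * (‖Y‖ ^ 4 / u ^ 250) := by gcongr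
      _ = D ^ 2 * ‖Y‖ ^ 4 / u ^ 250 := by ring
      _ ≤ _ := by
        have : 0 ≤ 2 * (l' * u ^ 128) := by positivity
        linarith
  set τ := u ^ 128 / n with hτ
  have hτ0 : 0 < τ := by positivity
  have hτ1 : τ ≤ 1 := (div_le_one hn0).2 hun
  have hl'u : l' ≤ (C + 1) * u ^ 125 := by
    have h1 : (1 : ℝ) ≤ u ^ 125 := one_le_pow₀ hu
    have h2 : C * ‖Y‖ ≤ C * u ^ 125 := by gcongr
    have h3 : 0 ≤ C * u ^ 125 := by positivity
    refine max_le ?_ ?_ <;> linarith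
  have hL2 : 1 ≤ L ^ 2 := one_le_pow₀ hL
  set Q := D ^ 2 + C + 1 with hQ
  have hQC : C + 1 ≤ Q := by linarith [sq_nonneg D]
  have hQ1 : 1 ≤ Q := by linarith
  have huL' : 128 * Q * L ^ 2 ≤ c * u ^ 3 := by
    have := mul_le_mul_of_nonneg_left huL hc0.le
    rwa [show c * (128 * Q / c * L ^ 2) = 128 * Q * L ^ 2 by field_simp] at this
  have hQu : 128 * Q * L ^ 2 ≤ u ^ 3 := by
    have : c * u ^ 3 ≤ 1 * u ^ 3 := by gcongr; linarith
    linarith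
  have hu3 : 16 ≤ u ^ 3 := by
    have : 1 * 1 ≤ Q * L ^ 2 := by gcongr
    linarith
  obtain ⟨m, δ, hm0, hml, hδ0, hδ1, hδ2, hR⟩ :=
    exists_restrictedIsometry hX hc hnN hC hu hun hL hlog (l := l') (by
      refine le_trans ?_ huL'
      gcongr) hl1 hl'u
  rw [← hτ] at hml
  have hm0' : (0 : ℝ) < m := by exact_mod_cast hm0
  set G := Finset.univ.filter fun j => |inner ℝ (X j) Y| ≤ u ^ 125 with hG
  set J := G.filter fun j => τ ≤ |β j| with hJ
  have hJτ : ∀ j ∈ J, τ ≤ |β j| := fun j hj => (Finset.mem_filter.1 hj).2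
  have hJm : J.card ≤ m := by
    have h1 := card_mul_le_sum_abs β hJτ
    have h2 : (J.card : ℝ) ≤ m := by
      refine le_trans ?_ hml
      rw [le_div_iff₀ hτ0]
      exact h1.trans hll
    exact_mod_cast h2
  have hlarge : ∑ j ∈ J, β j ^ 2 ≤ l' * u ^ 128 / n := by
    have h1 := hR.sum_sq_large_le hn0 hδ0 hδ1 hm0 (r := u ^ 125) (τ := τ) (by
      rw [hτ, mul_div_cancel₀ _ hn0.ne', le_div_iff₀ (by norm_num)]
      calc u ^ 125 * 16 ≤ u ^ 125 * u ^ 3 := by gcongr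
        _ = u ^ 128 := by ring) β hJm hJτ
      fun j hj => (Finset.mem_filter.1 (Finset.mem_filter.1 hj).1).2
    refine h1.trans ?_
    have h2 : (l / √m) ^ 2 ≤ (C + 1) * u ^ 253 / n := by
      rw [div_pow, Real.sq_sqrt hm0'.le, div_le_iff₀ hm0']
      have h3 : l' ≤ m * τ := (div_le_iff₀ hτ0).1 hml
      calc l ^ 2 ≤ l' * (m * τ) := by
            rw [sq]
            gcongr
            exact hll.trans h3
        _ ≤ (C + 1) * u ^ 125 * (m * τ) := by gcongr
        _ = _ := by rw [hτ]; ring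
    have h3 : √(∑ j, β j ^ 2) ^ 2 ≤ D ^ 2 * u ^ 253 / n := by
      rw [Real.sq_sqrt (Finset.sum_nonneg fun _ _ => sq_nonneg _)]
      refine hβ.trans ?_
      gcongr
      calc ‖Y‖ ^ 2 ≤ (u ^ 125) ^ 2 := by gcongr
        _ = u ^ 250 := by ring
        _ ≤ u ^ 253 := pow_le_pow_right₀ hu (by norm_num)
    have h4 : (√(∑ j, β j ^ 2) + l / √m) ^ 2 ≤ 2 * (Q * u ^ 253 / n) := by
      calc (√(∑ j, β j ^ 2) + l / √m) ^ 2 ≤ 2 * (√(∑ j, β j ^ 2) ^ 2 + (l / √m) ^ 2) :=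
            add_sq_le
        _ ≤ 2 * (D ^ 2 * u ^ 253 / n + (C + 1) * u ^ 253 / n) := by gcongr
        _ = _ := by rw [hQ]; ring
    -- `δ²` contributes `l' * L² / u^128` and the bracket `u^253 / n`; the spare factor `u^3`
    -- absorbs the constants and `L²`.
    calc 16 * δ ^ 2 * (√(∑ j, β j ^ 2) + l / √m) ^ 2
        ≤ 16 * δ ^ 2 * (2 * (Q * u ^ 253 / n)) := by gcongr
      _ = l' * (128 * Q * L ^ 2) * u ^ 125 / n := by
          rw [hδ2]
          field_simp
          ring
      _ ≤ l' * u ^ 3 * u ^ 125 / n := by gcongr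
      _ = _ := by ring
  have hsm : ∑ j ∈ G.filter (fun j => ¬ τ ≤ |β j|), β j ^ 2 ≤ l' * u ^ 128 / n := by
    refine (sum_sq_le_mul_sum_abs β hτ0.le fun j hj =>
      (not_le.1 (Finset.mem_filter.1 hj).2).le).trans ?_
    calc τ * l ≤ τ * l' := by gcongr
      _ = _ := by rw [hτ]; ring
  rw [← Finset.sum_filter_add_sum_filter_not G (fun j => τ ≤ |β j|)]
  calc _ ≤ l' * u ^ 128 / n + l' * u ^ 128 / n := add_le_add hlarge hsm
    _ = 2 * (l' * u ^ 128) / n := by ring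
    _ ≤ _ := by
        gcongr
        have : 0 ≤ D ^ 2 * ‖Y‖ ^ 4 / u ^ 250 := by positivity
        linarith

end Coefficients

end GaussianPolytope

/-! ### The `ℓ₁` norms of the averaged coefficient vectors -/

namespace GaussianPolytope

section Averages

variable {N n k : ℕ} {X : Fin N → EuclideanSpace ℝ (Fin n)} {c : ℝ}

theorem polyNorm_le_sum_abs_signExp (h0 : 0 < N) (y : Fin k → EuclideanSpace ℝ (Fin n))
    {b : (Fin k → ℤˣ) → Fin N → ℝ} (hb : ∀ σ, signSum y σ = ∑ j, b σ j • X j) (i : Fin k) :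
    polyNorm X (y i) ≤ ∑ j, |signExp (fun σ => (((σ i : ℤˣ) : ℤ) : ℝ) * b σ j)| := by
  have e : y i = ∑ j, signExp (fun σ => (((σ i : ℤˣ) : ℤ) : ℝ) * b σ j) • X j := by
    ext p
    have h1 : signExp (fun σ : Fin k → ℤˣ => (((σ i : ℤˣ) : ℤ) : ℝ) * signSum y σ p) = y i p := by
      have : (fun σ : Fin k → ℤˣ => (((σ i : ℤˣ) : ℤ) : ℝ) * signSum y σ p) = fun σ =>
          ∑ l, y l p * ((((σ i : ℤˣ) : ℤ) : ℝ) * (((σ l : ℤˣ) : ℤ) : ℝ)) := by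
        funext σ
        simp only [signSum, WithLp.ofLp_sum, WithLp.ofLp_smul, Finset.sum_apply, Pi.smul_apply,
          smul_eq_mul, Finset.mul_sum]
        exact Finset.sum_congr rfl fun l _ => by ring
      rw [this, signExp_sum]
      simp only [signExp_const_mul, signExp_sign_mul_sign, mul_ite, mul_one, mul_zero,
        Finset.sum_ite_eq, Finset.mem_univ, if_true]
    have h2 : (fun σ : Fin k → ℤˣ => (((σ i : ℤˣ) : ℤ) : ℝ) * signSum y σ p) = fun σ =>
        ∑ j, X j p * ((((σ i : ℤˣ) : ℤ) : ℝ) * b σ j) := by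
      funext σ
      rw [hb σ]
      simp only [WithLp.ofLp_sum, WithLp.ofLp_smul, Finset.sum_apply, Pi.smul_apply,
        smul_eq_mul, Finset.mul_sum]
      exact Finset.sum_congr rfl fun l _ => by ring
    rw [← h1, h2, signExp_sum]
    simp only [signExp_const_mul, WithLp.ofLp_sum, WithLp.ofLp_smul, Finset.sum_apply,
      Pi.smul_apply, smul_eq_mul]
    exact Finset.sum_congr rfl fun l _ => by ring
  conv_lhs => rw [e]
  exact polyNorm_sum_smul_le X h0 _

/-- Contribution of the pairs `(j, σ)` in which `j` belongs to a rare set of signs. -/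
theorem sum_sum_abs_signExp_rare_le (s : Finset (Fin N)) (b : (Fin k → ℤˣ) → Fin N → ℝ)
    (B : Fin N → Set (Fin k → ℤˣ)) [∀ j, DecidablePred (· ∈ B j)] {p : ℝ} (hp : 0 ≤ p)
    (hB : ∀ j ∈ s, signProb (B j) ≤ p ^ 2) :
    ∑ j ∈ s, ∑ i, |signExp (fun σ => (((σ i : ℤˣ) : ℤ) : ℝ) * (if σ ∈ B j then b σ j else 0))| ≤
      k * p * √(s.card * signExp (fun σ => ∑ j ∈ s, b σ j ^ 2)) := by
  have h : ∀ j ∈ s, ∑ i, |signExp (fun σ => (((σ i : ℤˣ) : ℤ) : ℝ) *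
      (if σ ∈ B j then b σ j else 0))| ≤ k * p * √(signExp (fun σ => b σ j ^ 2)) := by
    intro j hj
    refine (sum_abs_signExp_sign_mul_le_card_mul _).trans ?_
    rw [mul_assoc]
    gcongr
    have h1 := signExp_mul_sq_le (fun σ => |b σ j|) (fun σ => if σ ∈ B j then (1 : ℝ) else 0)
    simp only [sq_abs, ite_pow, one_pow, zero_pow two_ne_zero, ← signProb_eq_signExp] at h1
    have h2 : (fun σ => |if σ ∈ B j then b σ j else 0|) =
        fun σ => |b σ j| * (if σ ∈ B j then (1 : ℝ) else 0) := by
      funext σ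
      split_ifs <;> simp
    rw [h2]
    have h3 : 0 ≤ signExp (fun σ => b σ j ^ 2) := signExp_nonneg fun σ => sq_nonneg _
    refine le_trans (Real.le_sqrt_of_sq_le h1) ?_
    rw [mul_comm, Real.sqrt_mul' _ h3]
    gcongr
    exact Real.sqrt_le_iff.2 ⟨hp, hB j hj⟩
  refine (Finset.sum_le_sum h).trans ?_
  rw [← Finset.mul_sum]
  gcongr
  refine Real.le_sqrt_of_sq_le ((sq_sum_le_card_mul_sum_sq).trans ?_)
  rw [signExp_sum]
  gcongr with j
  rw [Real.sq_sqrt (signExp_nonneg fun σ => sq_nonneg _)]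

/-- Splitting the coordinates according to a fixed exceptional set `T` and, outside of `T`,
according to rare sets `B j` of signs. -/
theorem sum_sum_abs_signExp_le (b : (Fin k → ℤˣ) → Fin N → ℝ) (T : Finset (Fin N))
    (B : Fin N → Set (Fin k → ℤˣ)) [∀ j, DecidablePred (· ∈ B j)] {p q r t : ℝ} (hp : 0 ≤ p)
    (hB : ∀ j ∉ T, signProb (B j) ≤ p ^ 2) (hT : T.card ≤ t)
    (hq : signExp (fun σ => ∑ j, b σ j ^ 2) ≤ q)
    (hg : signExp (fun σ => ∑ j with σ ∉ B j, b σ j ^ 2) ≤ r) :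
    ∑ i, ∑ j, |signExp (fun σ => (((σ i : ℤˣ) : ℤ) : ℝ) * b σ j)| ≤
      √k * √(t * q) + (√k * √(N * r) + k * p * √(N * q)) := by
  have hT0 : 0 ≤ t := (Nat.cast_nonneg _).trans hT
  have hTN : (Tᶜ.card : ℝ) ≤ N := by
    have := Finset.card_le_univ Tᶜ
    rw [Fintype.card_fin] at this
    exact_mod_cast this
  have hsub : ∀ S : Finset (Fin N), signExp (fun σ => ∑ j ∈ S, b σ j ^ 2) ≤ q := fun S =>
    (signExp_mono fun σ => Finset.sum_le_sum_of_subset_of_nonneg (Finset.subset_univ _)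
      fun _ _ _ => sq_nonneg _).trans hq
  have hnn : ∀ (S : Finset (Fin N)) (f : Fin N → (Fin k → ℤˣ) → ℝ),
      0 ≤ signExp (fun σ => ∑ j ∈ S, f j σ ^ 2) := fun S f =>
    signExp_nonneg fun σ => Finset.sum_nonneg fun _ _ => sq_nonneg _
  rw [Finset.sum_comm, ← Finset.sum_add_sum_compl T]
  refine add_le_add ?_ ?_
  · refine (sum_sum_abs_signExp_sign_mul_le T fun j σ => b σ j).trans ?_
    gcongr
    · exact hnn T fun j σ => b σ j
    · exact hsub T
  have hsplit : ∀ j, ∑ i, |signExp (fun σ => (((σ i : ℤˣ) : ℤ) : ℝ) * b σ j)| ≤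
      ∑ i, |signExp (fun σ => (((σ i : ℤˣ) : ℤ) : ℝ) * (if σ ∉ B j then b σ j else 0))| +
      ∑ i, |signExp (fun σ => (((σ i : ℤˣ) : ℤ) : ℝ) * (if σ ∈ B j then b σ j else 0))| := by
    intro j
    rw [← Finset.sum_add_distrib]
    refine Finset.sum_le_sum fun i _ => ?_
    refine le_trans (le_of_eq ?_) (abs_add_le _ _)
    rw [← signExp_add]
    congr 2
    funext σ
    by_cases h : σ ∈ B j <;> simp [h]
  refine (Finset.sum_le_sum fun j _ => hsplit j).trans ?_
  rw [Finset.sum_add_distrib]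
  refine add_le_add ?_ ?_
  · refine (sum_sum_abs_signExp_sign_mul_le Tᶜ
      fun j σ => if σ ∉ B j then b σ j else 0).trans ?_
    gcongr
    · exact hnn Tᶜ fun j σ => if σ ∉ B j then b σ j else 0
    · refine (signExp_mono fun σ => ?_).trans hg
      simp only [ite_pow, zero_pow two_ne_zero]
      rw [Finset.sum_filter]
      exact Finset.sum_le_sum_of_subset_of_nonneg (Finset.subset_univ _) fun j _ _ => by
        split_ifs <;> positivity
  · refine (sum_sum_abs_signExp_rare_le Tᶜ b B hp
      fun j hj => hB j (Finset.mem_compl.1 hj)).trans ?_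
    gcongr
    · exact hnn Tᶜ fun j σ => b σ j
    · exact hsub _

/-- The three-way split with `k = u^200`: columns often bad, rare bad signs, and good pairs. The
first two gain over `u^200` from few indices and from tiny probability, the third from the small
coefficient mass. -/
theorem sum_polyNorm_le (hX : X ∈ sparseSingularValuesEvent N n c) {Ct : ℝ}
    (hX' : X ∈ dotProdStatEvent N n Ct) (hc0 : 0 < c) (hc : c ≤ 1 / 100) (hnN : n ≤ N)
    {K' : ℝ} (hK' : (N : ℝ) ≤ K' * n) (hCt : 0 ≤ Ct) {C D u : ℝ} (hC : 0 ≤ C) (hD : 0 ≤ D)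
    (hk : 2 ≤ k) (hkn : (k : ℝ) ≤ n / 2) (hu : 1 ≤ u) (huk : u ^ 200 = k)
    (hL : 1 ≤ Real.log k)
    (huL : 128 * (D ^ 2 + C + 1) / c * Real.log k ^ 2 ≤ u ^ 3)
    (huL5 : Real.log k ^ 5 ≤ u ^ 4) (huCt : Ct * Real.log k ^ 2 ≤ u ^ 25)
    {β : EuclideanSpace ℝ (Fin n) → Fin N → ℝ} (hβ : IsCoeffMap X β)
    (hβ1 : ∀ v, ∑ j, |β v j| ≤ C * ‖v‖) (hβ2 : ∀ v, ∑ j, β v j ^ 2 ≤ D ^ 2 * ‖v‖ ^ 2 / n)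
    {y : Fin k → EuclideanSpace ℝ (Fin n)} (hy : ∀ i, ‖y i‖ = 1)
    (hE : signExp (fun σ => polyNorm X (signSum y σ)) ≤ u ^ 25) :
    ∑ i, polyNorm X (y i) ≤ (D * √Ct + √(K' * (3 * D ^ 2 + 4)) + D * √K') * u ^ 177 := by
  classical
  have hu0 : 0 < u := by linarith
  have hk0 : (0 : ℝ) < k := by rw [← huk]; positivity
  have hn0 : (0 : ℝ) < n := by linarith
  have hN0 : 0 < N := by
    have : 0 < n := by exact_mod_cast hn0
    omega
  have hK0 : 0 ≤ K' := by
    by_contra! hlt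
    have := mul_neg_of_neg_of_pos hlt hn0
    have : (0 : ℝ) ≤ N := Nat.cast_nonneg N
    linarith
  have hsqrtk : √(k : ℝ) = u ^ 100 := by
    rw [← huk, show u ^ 200 = (u ^ 100) ^ 2 by ring, Real.sqrt_sq (by positivity)]
  set b : (Fin k → ℤˣ) → Fin N → ℝ := fun σ => β (signSum y σ) with hb
  have hbY : ∀ σ, signSum y σ = ∑ j, b σ j • X j := fun σ => (hβ _).1
  set B : Fin N → Set (Fin k → ℤˣ) :=
    fun j => {σ | u ^ 25 * √(k : ℝ) ≤ |inner ℝ (X j) (signSum y σ)|} with hBdef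
  set T : Finset (Fin N) := Finset.univ.filter fun j => 1 / (k : ℝ) ^ 100 ≤ signProb (B j) with hTdef
  -- `log (u^25) * log k ^ 4 ≤ log k ^ 5 ≤ u^4`, so `T` has at most `Ct * n / u^46` elements.
  have hT : (T.card : ℝ) ≤ n * (Ct * (u ^ 4) / u ^ 50) := by
    have h1 := hX'.1 k hk hkn (u ^ 25) huCt y hy
    have h2 : ({j : Fin N | 1 / (k : ℝ) ^ 100 ≤ signProb (B j)}.ncard : ℝ) = T.card := by
      rw [Set.ncard_eq_toFinset_card', hTdef]
      simp
    rw [h2] at h1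
    refine h1.trans ?_
    have h3 : Real.log (u ^ 25) ≤ Real.log k := by
      rw [← huk]
      exact Real.log_le_log (by positivity) (pow_le_pow_right₀ hu (by norm_num))
    calc n * (Ct * Real.log (u ^ 25) * Real.log k ^ 4 / (u ^ 25) ^ 2)
        ≤ n * (Ct * Real.log k * Real.log k ^ 4 / (u ^ 25) ^ 2) := by gcongr
      _ = n * (Ct * Real.log k ^ 5 / u ^ 50) := by ring
      _ ≤ _ := by gcongr
  have hq : signExp (fun σ => ∑ j, b σ j ^ 2) ≤ D ^ 2 * u ^ 200 / n := by
    calc signExp (fun σ => ∑ j, b σ j ^ 2)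
        ≤ signExp (fun σ => D ^ 2 / n * ‖signSum y σ‖ ^ 2) :=
          signExp_mono fun σ => (hβ2 _).trans_eq (by ring)
      _ = D ^ 2 * u ^ 200 / n := by
          rw [signExp_const_mul, signExp_norm_signSum_sq y hy, huk]
          ring
  -- The fourth moment is at most `3 u^400`, which gives `u^150` after division by `u^250`; the
  -- assumed bound `u^25` on the mean norm turns `u^128` into `u^153`.
  have hr : signExp (fun σ => ∑ j with σ ∉ B j, b σ j ^ 2) ≤ (3 * D ^ 2 + 4) * u ^ 153 / n := by
    have hpt : ∀ σ, ∑ j with σ ∉ B j, b σ j ^ 2 ≤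
        (D ^ 2 / u ^ 250 / n) * ‖signSum y σ‖ ^ 4 +
          (2 * u ^ 128 / n) * (polyNorm X (signSum y σ) + 1) := by
      intro σ
      have h1 := sum_sq_coeff_nearly_orthogonal_le hX hc0 hc hnN hC hu (D := D)
        (L := Real.log k) (by
          refine le_trans ?_ (show (k : ℝ) ≤ n by linarith)
          rw [← huk]
          exact pow_le_pow_right₀ hu (by norm_num)) hL (by
          rw [← huk]
          exact Real.log_le_log (by positivity) (pow_le_pow_right₀ hu (by norm_num))) huL (b σ)
        (by rw [← hbY]; exact hβ1 _) (by rw [← hbY]; exact hβ2 _)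
      rw [← hbY] at h1
      refine le_trans (Finset.sum_le_sum_of_subset_of_nonneg ?_ fun _ _ _ => sq_nonneg _)
        (h1.trans ?_)
      · intro j hj
        simp only [Finset.mem_filter, Finset.mem_univ, true_and, hBdef, Set.mem_ofPred_eq,
          not_le, hsqrtk] at hj ⊢
        rw [← pow_add] at hj
        exact hj.le
      · have h2 : ∑ j, |b σ j| = polyNorm X (signSum y σ) := (hβ _).2
        rw [h2]
        have h3 : 0 ≤ polyNorm X (signSum y σ) := gauge_nonneg _
        have h4 : max (polyNorm X (signSum y σ)) 1 ≤ polyNorm X (signSum y σ) + 1 :=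
          max_le (by linarith) (by linarith)
        calc _ ≤ (D ^ 2 * ‖signSum y σ‖ ^ 4 / u ^ 250 +
              2 * ((polyNorm X (signSum y σ) + 1) * u ^ 128)) / n := by gcongr
          _ = _ := by ring
    refine (signExp_mono hpt).trans ?_
    rw [signExp_add, signExp_const_mul, signExp_const_mul, signExp_add, signExp_const]
    have h4 := signExp_norm_signSum_pow_four_le y hy
    rw [← huk] at h4
    have h5 : (1 : ℝ) ≤ u ^ 25 := one_le_pow₀ hu
    calc _ ≤ D ^ 2 / u ^ 250 / n * (3 * (u ^ 200) ^ 2) + 2 * u ^ 128 / n * (u ^ 25 + u ^ 25) := by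
          gcongr
      _ = (3 * D ^ 2 * u ^ 150 + 4 * u ^ 153) / n := by
          field_simp
          ring
      _ ≤ (3 * D ^ 2 * u ^ 153 + 4 * u ^ 153) / n := by
          gcongr
          norm_num
      _ = _ := by ring
  have hmain := sum_sum_abs_signExp_le b T B (p := 1 / (k : ℝ) ^ 50) (by positivity)
    (fun j hj => by
      have : signProb (B j) < 1 / (k : ℝ) ^ 100 := by
        simpa [hTdef] using hj
      refine this.le.trans_eq ?_
      rw [div_pow, one_pow, ← pow_mul]) hT hq hr
  refine (Finset.sum_le_sum fun i _ => polyNorm_le_sum_abs_signExp hN0 y hbY i).trans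
    (hmain.trans ?_)
  have t1 : √(k : ℝ) * √(n * (Ct * u ^ 4 / u ^ 50) * (D ^ 2 * u ^ 200 / n)) =
      D * √Ct * u ^ 177 := by
    rw [show n * (Ct * u ^ 4 / u ^ 50) * (D ^ 2 * u ^ 200 / n) = (D * u ^ 77) ^ 2 * Ct by
      field_simp, Real.sqrt_mul (by positivity), Real.sqrt_sq (by positivity), hsqrtk]
    ring
  have hNr : ∀ r : ℝ, 0 ≤ r → (N : ℝ) * (r / n) ≤ K' * r := fun r hr => by
    calc (N : ℝ) * (r / n) ≤ K' * n * (r / n) := by gcongr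
      _ = _ := by field_simp
  -- The exponent is `100 + 153/2`, rounded up to 177.
  have t2 : √(k : ℝ) * √(N * ((3 * D ^ 2 + 4) * u ^ 153 / n)) ≤
      √(K' * (3 * D ^ 2 + 4)) * u ^ 177 := by
    calc √(k : ℝ) * √(N * ((3 * D ^ 2 + 4) * u ^ 153 / n))
        ≤ u ^ 100 * √(K' * (3 * D ^ 2 + 4) * (u ^ 77) ^ 2) := by
          rw [hsqrtk]
          refine mul_le_mul_of_nonneg_left (Real.sqrt_le_sqrt ?_) (by positivity)
          refine (hNr _ (by positivity)).trans ?_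
          rw [← pow_mul, ← mul_assoc]
          exact mul_le_mul_of_nonneg_left (pow_le_pow_right₀ hu (by norm_num)) (by positivity)
      _ = _ := by
          rw [Real.sqrt_mul (by positivity), Real.sqrt_sq (by positivity)]
          ring
  have t3 : (k : ℝ) * (1 / (k : ℝ) ^ 50) * √(N * (D ^ 2 * u ^ 200 / n)) ≤ D * √K' * u ^ 177 := by
    have h1 : (k : ℝ) * (1 / (k : ℝ) ^ 50) ≤ 1 := by
      rw [mul_one_div, div_le_one (by positivity)]
      exact le_self_pow₀ (by exact_mod_cast (by omega : 1 ≤ k)) (by norm_num)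
    calc (k : ℝ) * (1 / (k : ℝ) ^ 50) * √(N * (D ^ 2 * u ^ 200 / n))
        ≤ 1 * √(K' * (D * u ^ 100) ^ 2) := by
          refine mul_le_mul h1 (Real.sqrt_le_sqrt ?_) (Real.sqrt_nonneg _) zero_le_one
          refine (hNr _ (by positivity)).trans (le_of_eq ?_)
          ring
      _ = D * √K' * u ^ 100 := by
          rw [Real.sqrt_mul hK0, Real.sqrt_sq (by positivity)]
          ring
      _ ≤ _ := by
          gcongr
          norm_num
  rw [t1]
  linarith

end Averages

end GaussianPolytope

/-! ### Conclusion -/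

namespace GaussianPolytope

section Conclusion

open Filter

/-! ### Thresholds in `k`: powers of `u = k^(1/200)` against logarithms and powers. -/

theorem eventually_mul_log_pow_le (a : ℝ) (p : ℕ) {m : ℕ} (hm : 0 < m) :
    ∀ᶠ x : ℝ in atTop, a * Real.log x ^ p ≤ (x ^ (1 / 200 : ℝ)) ^ m := by
  have h := isLittleO_log_rpow_rpow_atTop (p : ℝ) (s := (m : ℝ) / 200) (by positivity)
  have h1 := (h.const_mul_left a).bound one_pos
  filter_upwards [h1, eventually_ge_atTop 0] with x hx hx0
  have e : (x ^ (1 / 200 : ℝ)) ^ m = x ^ ((m : ℝ) / 200) := by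
    rw [← Real.rpow_mul_natCast hx0]
    congr 1
    ring
  rw [Real.rpow_natCast, one_mul, Real.norm_of_nonneg (Real.rpow_nonneg hx0 _)] at hx
  rw [e]
  exact (le_abs_self _).trans hx

theorem eventually_mul_pow_lt_rpow (a : ℝ) {m : ℕ} {s : ℝ} (hms : (m : ℝ) / 200 < s) :
    ∀ᶠ x : ℝ in atTop, a * (x ^ (1 / 200 : ℝ)) ^ m < x ^ s := by
  have h := (tendsto_rpow_atTop (sub_pos.2 hms)).eventually_gt_atTop a
  filter_upwards [h, eventually_gt_atTop 0] with x hx hx0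
  have e : (x ^ (1 / 200 : ℝ)) ^ m = x ^ ((m : ℝ) / 200) := by
    rw [← Real.rpow_mul_natCast hx0.le]
    congr 1
    ring
  rw [e]
  calc a * x ^ ((m : ℝ) / 200) < x ^ (s - (m : ℝ) / 200) * x ^ ((m : ℝ) / 200) := by gcongr
    _ = x ^ s := by rw [← Real.rpow_add hx0, sub_add_cancel]

variable {N n : ℕ} {X : Fin N → EuclideanSpace ℝ (Fin n)} {c : ℝ}

/-- The Euclidean norm dominates the polytope norm, and the polytope norm is attained. -/
theorem exists_isCoeffMap_and_polyNorm_le (hX : X ∈ sparseSingularValuesEvent N n c) {K K' : ℝ}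
    (hK : 1 < K) (hn : 0 < n) (hKn : K * n ≤ N) (hK' : (N : ℝ) ≤ K' * n) :
    (∃ β, IsCoeffMap X β) ∧ ∀ v, polyNorm X v ≤ 2 * √K' / (√K - 1) * ‖v‖ := by
  have hn0 : (0 : ℝ) < n := by exact_mod_cast hn
  have hN0 : 0 < N := by
    have : (0 : ℝ) < N := lt_of_lt_of_le (by positivity) hKn
    exact_mod_cast this
  have hsK : 1 < √K := by rwa [Real.lt_sqrt zero_le_one, one_pow]
  have hs : 0 < 1 / 2 * ((√K - 1) * √(n : ℝ)) := by
    have : 0 < √K - 1 := by linarith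
    positivity
  have hsN : √K * √(n : ℝ) ≤ √(N : ℝ) := by
    rw [← Real.sqrt_mul (by linarith)]
    exact Real.sqrt_le_sqrt hKn
  have hNs : √(N : ℝ) ≤ √K' * √(n : ℝ) := by
    rw [← Real.sqrt_mul' _ hn0.le]
    exact Real.sqrt_le_sqrt hK'
  have hco := exists_coeff_of_le_sqrt_sum_inner_sq (X := X) hs fun w =>
    le_trans (mul_le_mul_of_nonneg_right (by linarith) (norm_nonneg w))
      (mul_norm_le_sqrt_sum_inner_sq hX w)
  refine ⟨?_, fun v => ?_⟩
  · choose β h1 h2 using exists_coeff_sum_abs_eq_polyNorm hN0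
      fun v => (hco v).imp fun β h => h.1
    exact ⟨β, fun v => ⟨h1 v, h2 v⟩⟩
  · obtain ⟨β, h1, h2⟩ := hco v
    have h3 : ∑ j, |β j| ≤ √(N : ℝ) * √(∑ j, β j ^ 2) := by
      rw [← Real.sqrt_mul (Nat.cast_nonneg N)]
      refine Real.le_sqrt_of_sq_le (sq_sum_le_card_mul_sum_sq.trans ?_)
      simp
    calc polyNorm X v = polyNorm X (∑ j, β j • X j) := by rw [← h1]
      _ ≤ ∑ j, |β j| := polyNorm_sum_smul_le X hN0 β
      _ ≤ √(N : ℝ) * √(∑ j, β j ^ 2) := h3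
      _ ≤ √K' * √(n : ℝ) * (‖v‖ / (1 / 2 * ((√K - 1) * √(n : ℝ)))) := by gcongr
      _ = _ := by
        have : √K - 1 ≠ 0 := by linarith
        field_simp

end Conclusion

end GaussianPolytope

open GaussianPolytope Filter

theorem mainTheorem4 (K K' : ℝ) (hK : 1 < K) (hKK' : K ≤ K')
    (c : ℝ) (hc0 : 0 < c) (hc1 : c ≤ 1 / 100) (Ct : ℝ) (hCt : 2 * c⁻¹ < Ct) :
    ∃ C : ℝ, 1 ≤ C ∧
      ∀ n N : ℕ, c⁻¹ ≤ (n : ℝ) → K ≤ (N : ℝ) / n → (N : ℝ) / n ≤ K' →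
      ∀ X : Fin N → EuclideanSpace ℝ (Fin n),
        X ∈ GaussianPolytope.sparseSingularValuesEvent N n c ∩
          GaussianPolytope.dotProdStatEvent N n Ct →
      ∀ k : ℕ, 1 ≤ k → (k : ℝ) ≤ (n : ℝ) / 2 →
      ∀ y : Fin k → EuclideanSpace ℝ (Fin n),
        (∀ i, ‖y i‖ = 1) →
        (∀ i, C * (k : ℝ) ^ (-(1 / 9 : ℝ)) ≤ GaussianPolytope.polyNorm X (y i)) →
        -- the expected norm of a random sign combination is large
        (k : ℝ) ^ (1 / 8 : ℝ) ≤
            GaussianPolytope.signExp (fun σ =>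
              GaussianPolytope.polyNorm X (GaussianPolytope.signSum y σ)) ∧
        -- the same in terms of the coefficient vectors
        (∃ β, GaussianPolytope.IsCoeffMap X β) ∧
        (∀ β, GaussianPolytope.IsCoeffMap X β →
          GaussianPolytope.signExp (fun σ =>
              ∑ j, |β (GaussianPolytope.signSum y σ) j|) =
            GaussianPolytope.signExp (fun σ =>
              GaussianPolytope.polyNorm X (GaussianPolytope.signSum y σ))) ∧
        -- the distortion of the map sending the standard basis of `ℓ_∞ᵏ` to `y` is at least
        -- a constant times `k ^ (1/8)` (the norm on `Fin k → ℝ` is the sup norm)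
        (∀ a b : ℝ, 0 < a → 0 < b →
          (∀ v : Fin k → ℝ,
            a * ‖v‖ ≤ GaussianPolytope.polyNorm X (∑ i, v i • y i) ∧
            GaussianPolytope.polyNorm X (∑ i, v i • y i) ≤ b * ‖v‖) →
          (k : ℝ) ^ (1 / 8 : ℝ) ≤ C * (b / a)) := by
  have hsK : 1 < √K := by rwa [Real.lt_sqrt zero_le_one, one_pow]
  obtain ⟨C₁, hC₁⟩ : ∃ C₁, C₁ = 2 * √K' / (√K - 1) := ⟨_, rfl⟩
  have hC₁0 : 0 ≤ C₁ := by
    have : 0 < √K - 1 := by linarith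
    rw [hC₁]
    positivity
  obtain ⟨D, hD⟩ : ∃ D, D = 2 + (8 * √(2 * K' / c) + √(2 / c)) * C₁ := ⟨_, rfl⟩
  have hD0 : 0 ≤ D := by rw [hD]; positivity
  have hCt0 : 0 ≤ Ct := by
    have := inv_pos.2 hc0
    linarith
  obtain ⟨x₀, hx₀⟩ := eventually_atTop.1 ((eventually_ge_atTop 2).and
    ((Real.tendsto_log_atTop.eventually_ge_atTop 1).and
    ((eventually_mul_log_pow_le (128 * (D ^ 2 + C₁ + 1) / c) 2 (m := 3) (by norm_num)).and
    ((eventually_mul_log_pow_le 1 5 (m := 4) (by norm_num)).and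
    ((eventually_mul_log_pow_le Ct 2 (m := 25) (by norm_num)).and
    (eventually_mul_pow_lt_rpow (D * √Ct + √(K' * (3 * D ^ 2 + 4)) + D * √K') (m := 177)
      (s := 8 / 9) (by norm_num)))))))
  set x₁ := max x₀ 1 with hx₁
  have hx₁1 : 1 ≤ x₁ ^ (1 / 9 : ℝ) := Real.one_le_rpow (le_max_right _ _) (by norm_num)
  -- The power of `x₁` makes the hypothesis on `y` impossible for `k < x₀`; `C ≥ 1` is used for
  -- large `k`, and `C ≥ C₁` for the distortion.
  refine ⟨C₁ * x₁ ^ (1 / 9 : ℝ) + 1, by nlinarith, ?_⟩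
  intro n N hcn hKN hNK X hX k hk1 hkn y hy hyP
  have hn0 : (0 : ℝ) < n := (inv_pos.2 hc0).trans_le hcn
  have hn : 0 < n := by exact_mod_cast hn0
  rw [le_div_iff₀ hn0] at hKN
  rw [div_le_iff₀ hn0] at hNK
  have hnN : n ≤ N := by
    have : (n : ℝ) ≤ N := by nlinarith
    exact_mod_cast this
  have hk0 : (0 : ℝ) < k := by exact_mod_cast hk1
  obtain ⟨hex, hle⟩ := exists_isCoeffMap_and_polyNorm_le hX.1 hK hn hKN hNK
  rw [← hC₁] at hle
  have hmain : (k : ℝ) ^ (1 / 8 : ℝ) ≤ signExp (fun σ => polyNorm X (signSum y σ)) := by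
    by_contra! hlt
    rcases lt_or_ge (k : ℝ) x₀ with hkx | hkx
    · -- for few signs the hypothesis on the norms of the `y i` cannot hold
      have h1 := (hyP ⟨0, hk1⟩).trans (hle _)
      rw [hy, mul_one, Real.rpow_neg hk0.le, ← div_eq_mul_inv,
        div_le_iff₀ (Real.rpow_pos_of_pos hk0 _)] at h1
      have h2 : (k : ℝ) ^ (1 / 9 : ℝ) ≤ x₁ ^ (1 / 9 : ℝ) :=
        Real.rpow_le_rpow hk0.le (hkx.le.trans (le_max_left _ _)) (by norm_num)
      have h3 := mul_le_mul_of_nonneg_left h2 hC₁0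
      linarith
    obtain ⟨a1, a2, a3, a4, a5, a6⟩ := hx₀ k hkx
    set u : ℝ := (k : ℝ) ^ (1 / 200 : ℝ) with hu
    have hu1 : 1 ≤ u := Real.one_le_rpow (by linarith) (by norm_num)
    have huk : u ^ 200 = k := by
      rw [hu, ← Real.rpow_mul_natCast hk0.le]
      norm_num
    have hu25 : u ^ 25 = (k : ℝ) ^ (1 / 8 : ℝ) := by
      rw [hu, ← Real.rpow_mul_natCast hk0.le]
      norm_num
    obtain ⟨β, hβ⟩ := hex
    have hβ1 : ∀ v, ∑ j, |β v j| ≤ C₁ * ‖v‖ := fun v => (hβ v).2.trans_le (hle v)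
    have hβ2 : ∀ v, ∑ j, β v j ^ 2 ≤ D ^ 2 * ‖v‖ ^ 2 / n := by
      intro v
      have h1 := sqrt_sum_sq_coeff_le hX.1 hc0 hc1 hcn hnN hNK (β v)
      rw [← (hβ v).1] at h1
      have h2 : √(∑ j, β v j ^ 2) ≤ D * ‖v‖ / √(n : ℝ) := by
        refine h1.trans ?_
        gcongr
        calc _ ≤ 2 * ‖v‖ + (8 * √(2 * K' / c) + √(2 / c)) * (C₁ * ‖v‖) := by
              gcongr
              exact hβ1 v
          _ = D * ‖v‖ := by rw [hD]; ring
      refine (Real.sqrt_le_iff.1 h2).2.trans_eq ?_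
      rw [div_pow, Real.sq_sqrt hn0.le, mul_pow]
    have h1 := sum_polyNorm_le hX.1 hX.2 hc0 hc1 hnN hNK hCt0 hC₁0 hD0
      (by exact_mod_cast a1) hkn hu1 huk a2 a3 (by linarith) a5 hβ hβ1 hβ2 hy
      (hu25 ▸ hlt.le)
    have h2 : (k : ℝ) ^ (8 / 9 : ℝ) ≤ ∑ i, polyNorm X (y i) := by
      have h3 : ∀ i, (k : ℝ) ^ (-(1 / 9 : ℝ)) ≤ polyNorm X (y i) := fun i => by
        refine le_trans (le_mul_of_one_le_left (Real.rpow_nonneg hk0.le _) ?_) (hyP i)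
        have : 0 ≤ C₁ * x₁ ^ (1 / 9 : ℝ) := by positivity
        linarith
      calc (k : ℝ) ^ (8 / 9 : ℝ) = k * (k : ℝ) ^ (-(1 / 9 : ℝ)) := by
            rw [← Real.rpow_one_add' hk0.le (by norm_num)]
            norm_num
        _ = ∑ _i : Fin k, (k : ℝ) ^ (-(1 / 9 : ℝ)) := by simp
        _ ≤ _ := Finset.sum_le_sum fun i _ => h3 i
    linarith
  refine ⟨hmain, hex, fun β hβ => ?_, fun a b ha hb hab => ?_⟩
  · simp only [fun v => (hβ v).2]
  -- Sign vectors have sup norm at most 1, so `b` bounds the mean; testing one basis vector gives `a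
  -- ≤ C₁`.
  · have hb' : signExp (fun σ => polyNorm X (signSum y σ)) ≤ b := by
      rw [← signExp_const (k := k) b]
      refine signExp_mono fun σ => ?_
      refine ((hab fun i => (((σ i : ℤˣ) : ℤ) : ℝ)).2).trans ?_
      refine mul_le_of_le_one_right hb.le ((pi_norm_le_iff_of_nonneg zero_le_one).2 fun i => ?_)
      rcases Int.units_eq_one_or (σ i) with h | h <;> simp [h]
    have ha' : a ≤ C₁ := by
      have h1 := (hab (Pi.single ⟨0, hk1⟩ 1)).1
      have h2 : ∑ i, (Pi.single (⟨0, hk1⟩ : Fin k) (1 : ℝ) : Fin k → ℝ) i • y i = y ⟨0, hk1⟩ := by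
        simp [Pi.single_apply]
      rw [h2, Pi.norm_single, norm_one, mul_one] at h1
      refine h1.trans ((hle _).trans_eq ?_)
      rw [hy, mul_one]
    refine hmain.trans (hb'.trans ?_)
    rw [mul_div_assoc', le_div_iff₀ ha, mul_comm]
    gcongr
    nlinarith
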